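/- Let $d\ge 2$. Let $k:\mathbb R^d\setminus\{0\}\to\mathbb C$ be smooth, homogeneous of degree $-d$ (that is, $k(tx)=t^{-d}k(x)$ for $t>0$, $x\neq 0$), with mean value zero on every sphere centred at the origin. Let $K$ be the corresponding translation-invariant Calderón–Zygmund operator, that is, the bounded operator on $L^2(\mathbb R^d)$ given for $\varphi\in C_c^\infty(\mathbb R^d)$ by $$(K\varphi)(x)=\lim_{\varepsilon\to0^+}\int_{|x-y|>\varepsilon}k(x-y)\,\varphi(y)\,dy\qquad\text{for a.e. } x$$ (for instance, a Riesz transform), and assume $K\neq0$. For $f\in L^1_{\rm loc}(\mathbb R^d)$ let $$\|f\|_{BMO}=\sup_{a\in\mathbb R^d,\,r>0}\frac1{|B_r(a)|}\int_{B_r(a)}\Big|f(x)-\frac1{|B_r(a)|}\int_{B_r(a)}f(y)\,dy\Big|\,dx ,$$ let $BMO(\mathbb R^d)$ be the space of those (complex-valued) $f$ for which this is finite, and let $CMO(\mathbb R^d)$ be the closure of $C_c^\infty(\mathbb R^d)$ in $BMO(\mathbb R^d)$. Let $f\in CMO(\mathbb R^d)$, and let $[K,f]=Kf-fK$ be the commutator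 of $K$ with the operator of multiplication by $f$, considered as an operator in $L^2(\mathbb R^d)$. Let $s_1([K,f])\ge s_2([K,f])\ge\cdots$ be its singular values, repeated according to multiplicity; that is, $s_n$ is the distance in operator norm from $[K,f]$ to the operators of rank less than $n$ (for a compact operator $T$, these are the square roots of the eigenvalues of $T^*T$, counted with multiplicity, in nonincreasing order). If $$\liminf_{N\to\infty}N^{-1+1/d}\sum_{n=1}^N s_n([K,f])=0,$$ then $f$ is constant (almost everywhere). -/

import Mathlib

open MeasureTheory Filter Topology
open scoped ENNReal ContDiff InnerProductSpace

noncomputable section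

namespace CZCommutator

/-- `ℝ^d` with its Euclidean norm. -/
abbrev E (d : ℕ) : Type := EuclideanSpace ℝ (Fin d)

/-- The complex Hilbert space `L²(ℝ^d)`. -/
abbrev L2 (d : ℕ) : Type := Lp ℂ 2 (volume : Measure (E d))

/-! ### Bounded and vanishing mean oscillation -/

/-- The mean oscillation of `f` on the ball of centre `a` and radius `r`. -/
def meanOsc {d : ℕ} (f : E d → ℂ) (a : E d) (r : ℝ) : ℝ :=
  ⨍ x in Metric.ball a r, ‖f x - ⨍ y in Metric.ball a r, f y‖

/-- The `BMO` seminorm (for locally integrable `f`), with values in `[0, ∞]`. -/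
def bmoSeminorm {d : ℕ} (f : E d → ℂ) : ℝ≥0∞ :=
  ⨆ (a : E d) (r : ℝ) (_ : 0 < r), ENNReal.ofReal (meanOsc f a r)

/-- Functions of bounded mean oscillation. -/
def MemBMO {d : ℕ} (f : E d → ℂ) : Prop :=
  LocallyIntegrable f ∧ bmoSeminorm f < ⊤

/-- `CMO(ℝ^d)`: the closure in `BMO(ℝ^d)` of the smooth compactly supported functions. -/
def MemCMO {d : ℕ} (f : E d → ℂ) : Prop :=
  MemBMO f ∧ ∀ ε : ℝ≥0∞, 0 < ε →
    ∃ g : E d → ℂ, ContDiff ℝ ∞ g ∧ HasCompactSupport g ∧ bmoSeminorm (fun x => f x - g x) < ε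

/-! ### Homogeneous translation-invariant Calderón–Zygmund operators -/

/-- Convolution kernels that are smooth away from the origin, homogeneous of degree `-d`, and have
mean value zero on the spheres centred at the origin. (The value of `k` at `0` is irrelevant.) -/
structure IsCZKernel {d : ℕ} (k : E d → ℂ) : Prop where
  smooth : ContDiffOn ℝ ∞ k {0}ᶜ
  homogeneous : ∀ t : ℝ, 0 < t → ∀ x : E d, x ≠ 0 → k (t • x) = ((t ^ d)⁻¹ : ℝ) • k x
  mean_zero : ∀ r : ℝ, 0 < r →
    ∫ θ : Metric.sphere (0 : E d) 1, k (r • (θ : E d)) ∂(volume : Measure (E d)).toSphere = 0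

/-- The bounded operator `K` on `L²(ℝ^d)` is the singular integral operator with convolution
kernel `k`: on smooth compactly supported functions `φ` it is given by the principal value
`(K φ)(x) = lim_{ε → 0+} ∫_{|x - y| > ε} k (x - y) φ(y) dy`. -/
def IsSingularIntegral {d : ℕ} (k : E d → ℂ) (K : L2 d →L[ℂ] L2 d) : Prop :=
  ∀ φ : E d → ℂ, ContDiff ℝ ∞ φ → HasCompactSupport φ → ∀ hφ : MemLp φ 2 (volume : Measure (E d)),
    ∀ᵐ x : E d, Tendsto (fun ε : ℝ => ∫ y in {y : E d | ε < ‖x - y‖}, k (x - y) * φ y)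
      (𝓝[>] 0) (𝓝 (K (hφ.toLp φ) x))

/-- Homogeneous translation-invariant Calderón–Zygmund operators on `L²(ℝ^d)`. -/
def IsCZOperator {d : ℕ} (K : L2 d →L[ℂ] L2 d) : Prop :=
  ∃ k : E d → ℂ, IsCZKernel k ∧ IsSingularIntegral k K

/-! ### The commutator -/

/-- The natural domain of `K f - f K` in `L²(ℝ^d)`, where `f` stands for the operator of
multiplication by `f`: all `φ ∈ L²` with `f φ ∈ L²` and `f (K φ) ∈ L²`. -/
def commutatorDomain {d : ℕ} (K : L2 d →L[ℂ] L2 d) (f : E d → ℂ) : Submodule ℂ (L2 d) where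
  carrier := {φ | MemLp (fun x => f x * φ x) 2 (volume : Measure (E d)) ∧
    MemLp (fun x => f x * K φ x) 2 (volume : Measure (E d))}
  zero_mem' := by
    constructor
    · refine (memLp_congr_ae ?_).1 (MemLp.zero (ε := ℂ))
      filter_upwards [Lp.coeFn_zero ℂ 2 (volume : Measure (E d))] with x hx
      simp
    · refine (memLp_congr_ae ?_).1 (MemLp.zero (ε := ℂ))
      filter_upwards [Lp.coeFn_zero ℂ 2 (volume : Measure (E d))] with x hx
      simp
  add_mem' := by
    rintro a b ⟨ha, ha'⟩ ⟨hb, hb'⟩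
    constructor
    · refine (memLp_congr_ae ?_).1 (ha.add hb)
      filter_upwards [Lp.coeFn_add a b] with x hx
      simp only [hx, Pi.add_apply, mul_add]
    · refine (memLp_congr_ae ?_).1 (ha'.add hb')
      rw [map_add]
      filter_upwards [Lp.coeFn_add (K a) (K b)] with x hx
      simp only [hx, Pi.add_apply, mul_add]
  smul_mem' := by
    rintro c a ⟨ha, ha'⟩
    constructor
    · refine (memLp_congr_ae ?_).1 (ha.const_smul c)
      filter_upwards [Lp.coeFn_smul c a] with x hx
      simp [hx, mul_left_comm]
    · refine (memLp_congr_ae ?_).1 (ha'.const_smul c)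
      rw [map_smul]
      filter_upwards [Lp.coeFn_smul c (K a)] with x hx
      simp [hx, mul_left_comm]

/-- The commutator `[K, f] = K f - f K` as an operator in `L²(ℝ^d)` with its natural domain. (For
`f ∈ BMO(ℝ^d)` this domain is dense, because it contains the test functions.) -/
def commutator {d : ℕ} (K : L2 d →L[ℂ] L2 d) (f : E d → ℂ) : L2 d →ₗ.[ℂ] L2 d where
  domain := commutatorDomain K f
  toFun :=
    { toFun := fun φ => K (φ.2.1.toLp _) - φ.2.2.toLp _
      map_add' := by
        rintro ⟨a, ha⟩ ⟨b, hb⟩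
        have h1 : MemLp.toLp _ ((commutatorDomain K f).add_mem ha hb).1
            = MemLp.toLp _ ha.1 + MemLp.toLp _ hb.1 := by
          rw [← MemLp.toLp_add]
          refine (MemLp.toLp_eq_toLp_iff _ _).2 ?_
          filter_upwards [Lp.coeFn_add a b] with x hx
          simp only [hx, Pi.add_apply, mul_add]
        have h2 : MemLp.toLp _ ((commutatorDomain K f).add_mem ha hb).2
            = MemLp.toLp _ ha.2 + MemLp.toLp _ hb.2 := by
          rw [← MemLp.toLp_add]
          refine (MemLp.toLp_eq_toLp_iff _ _).2 ?_
          rw [map_add]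
          filter_upwards [Lp.coeFn_add (K a) (K b)] with x hx
          simp only [hx, Pi.add_apply, mul_add]
        change K (MemLp.toLp _ ((commutatorDomain K f).add_mem ha hb).1)
          - MemLp.toLp _ ((commutatorDomain K f).add_mem ha hb).2 = _
        rw [h1, h2, map_add]
        abel
      map_smul' := by
        rintro c ⟨a, ha⟩
        have h1 : MemLp.toLp _ ((commutatorDomain K f).smul_mem c ha).1
            = c • MemLp.toLp _ ha.1 := by
          rw [← MemLp.toLp_const_smul]
          refine (MemLp.toLp_eq_toLp_iff _ _).2 ?_
          filter_upwards [Lp.coeFn_smul c a] with x hx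
          simp [hx, mul_left_comm]
        have h2 : MemLp.toLp _ ((commutatorDomain K f).smul_mem c ha).2
            = c • MemLp.toLp _ ha.2 := by
          rw [← MemLp.toLp_const_smul]
          refine (MemLp.toLp_eq_toLp_iff _ _).2 ?_
          rw [map_smul]
          filter_upwards [Lp.coeFn_smul c (K a)] with x hx
          simp [hx, mul_left_comm]
        change K (MemLp.toLp _ ((commutatorDomain K f).smul_mem c ha).1)
          - MemLp.toLp _ ((commutatorDomain K f).smul_mem c ha).2 = _
        rw [h1, h2, map_smul, ← smul_sub]
        rfl }

/-! ### Singular values -/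

/-- The singular values `s₀(A) ≥ s₁(A) ≥ …` (numbered from `0`, repeated according to multiplicity)
of a densely defined operator `A` in a Hilbert space: `sₙ(A)` is the distance, in operator norm, of
`A` from the operators of rank at most `n`. If `A` has a compact extension `T` to the whole
space, they are the square roots of the eigenvalues of `T* T`, counted with multiplicity and
arranged in nonincreasing order; see `singularValue_le_iff`. -/
def singularValue {H : Type*} [NormedAddCommGroup H] [InnerProductSpace ℂ H]
    (A : H →ₗ.[ℂ] H) (n : ℕ) : ℝ≥0∞ :=
  ⨅ (F : H →L[ℂ] H) (_ : (F : H →ₗ[ℂ] H).rank ≤ n),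
    ⨆ (x : A.domain) (_ : ‖(x : H)‖ ≤ 1), ‖A x - F x‖ₑ

/-- The supremum in the definition of `singularValue` is an operator norm. -/
theorem iSup_enorm_le_iff {H : Type*} [NormedAddCommGroup H] [InnerProductSpace ℂ H]
    (T F : H →L[ℂ] H) (D : Submodule ℂ H) (hD : Dense (D : Set H)) (c : ℝ) (hc : 0 ≤ c) :
    (⨆ (x : ((T : H →ₗ[ℂ] H).toPMap D).domain) (_ : ‖(x : H)‖ ≤ 1),
      ‖(T : H →ₗ[ℂ] H).toPMap D x - F x‖ₑ) ≤ ENNReal.ofReal c ↔ ∀ x : H, ‖T x - F x‖ ≤ c * ‖x‖ := by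
  have key : ∀ x : H, ‖T x - F x‖ₑ ≤ ENNReal.ofReal c ↔ ‖T x - F x‖ ≤ c := by
    intro x
    rw [← ofReal_norm, ENNReal.ofReal_le_ofReal_iff hc]
  constructor
  · intro h x
    have hcl : IsClosed {x : H | ‖T x - F x‖ ≤ c * ‖x‖} :=
      isClosed_le (by fun_prop) (by fun_prop)
    refine hcl.closure_subset_iff.2 ?_ (hD x)
    intro y hy
    rcases eq_or_ne y 0 with rfl | hy0
    · simp
    have hn : 0 < ‖y‖ := norm_pos_iff.2 hy0
    have h1 : ‖T ((‖y‖⁻¹ : ℂ) • y) - F ((‖y‖⁻¹ : ℂ) • y)‖ ≤ c := by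
      rw [← key]
      refine le_trans ?_ h
      refine le_iSup₂_of_le (⟨(‖y‖⁻¹ : ℂ) • y, D.smul_mem _ hy⟩ : D) ?_ le_rfl
      simp [norm_smul, hn.ne']
    rw [map_smul, map_smul, ← smul_sub, norm_smul] at h1
    simp only [norm_inv, Complex.norm_real, norm_norm] at h1
    rwa [inv_mul_le_iff₀ hn, mul_comm] at h1
  · intro h
    refine iSup₂_le fun x hx => ?_
    refine (key x).2 ((h x).trans ?_)
    exact mul_le_of_le_one_right hc hx

open Module.End in
/-- For an operator with a compact extension `T`, the number `sₙ` is the square root of the `n`-th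
largest eigenvalue (numbered from `0`, with multiplicity) of `T* T`: one has `sₙ ≤ σ` if and only
if `T* T` has at most `n` eigenvalues above `σ²`, counted with multiplicity. -/
theorem singularValue_le_iff {H : Type*} [NormedAddCommGroup H] [InnerProductSpace ℂ H]
    [CompleteSpace H] (T : H →L[ℂ] H) (hT : IsCompactOperator T) (D : Submodule ℂ H)
    (hD : Dense (D : Set H)) (n : ℕ) (σ : ℝ) (hσ : 0 ≤ σ) :
    singularValue ((T : H →ₗ[ℂ] H).toPMap D) n ≤ ENNReal.ofReal σ ↔
      Module.rank ℂ (⨆ μ : {μ : ℝ // σ ^ 2 < μ},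
        eigenspace (ContinuousLinearMap.adjoint T ∘L T : H →ₗ[ℂ] H) (μ : ℂ) : Submodule ℂ H) ≤ n := by
  set A : H →L[ℂ] H := ContinuousLinearMap.adjoint T ∘L T with hA
  have hin : ∀ x y : H, ⟪A x, y⟫_ℂ = ⟪T x, T y⟫_ℂ := fun x y => by
    simp [hA, ContinuousLinearMap.adjoint_inner_left]
  have hsymm : (A : H →ₗ[ℂ] H).IsSymmetric := fun x y => by
    change ⟪A x, y⟫_ℂ = ⟪x, A y⟫_ℂ
    rw [hin, ← inner_conj_symm x, hin, inner_conj_symm]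
  have hcomp : IsCompactOperator A := hT.clm_comp (ContinuousLinearMap.adjoint T)
  set V : Submodule ℂ H := ⨆ μ : {μ : ℝ // σ ^ 2 < μ}, eigenspace (A : H →ₗ[ℂ] H) (μ : ℂ) with hV
  have hanti : ∀ τ τ' : ℝ, τ ≤ τ' →
      (⨆ μ : {μ : ℝ // τ' ≤ μ}, eigenspace (A : H →ₗ[ℂ] H) (μ : ℂ) : Submodule ℂ H) ≤
        ⨆ μ : {μ : ℝ // τ ≤ μ}, eigenspace (A : H →ₗ[ℂ] H) (μ : ℂ) := fun τ τ' hle =>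
    iSup_le fun μ => le_iSup (fun μ : {μ : ℝ // τ ≤ μ} => eigenspace (A : H →ₗ[ℂ] H) (μ : ℂ))
      ⟨μ, hle.trans μ.2⟩
  constructor
  · intro h
    by_contra hrank
    push Not at hrank
    obtain ⟨τ, hτ, hτr⟩ : ∃ τ : ℝ, σ ^ 2 < τ ∧ (n : Cardinal) <
        Module.rank ℂ (⨆ μ : {μ : ℝ // τ ≤ μ}, eigenspace (A : H →ₗ[ℂ] H) (μ : ℂ) :
          Submodule ℂ H) := by
      have h1 : ((n + 1 : ℕ) : Cardinal) ≤ Module.rank ℂ V := by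
        rw [Nat.cast_succ]; exact Order.succ_le_of_lt hrank |>.trans' (by simp)
      obtain ⟨s, hs, hli⟩ := le_rank_iff_exists_linearIndependent_finset.1 h1
      have hex : ∀ v : V, ∃ τ : ℝ, σ ^ 2 < τ ∧
          (v : H) ∈ (⨆ μ : {μ : ℝ // τ ≤ μ}, eigenspace (A : H →ₗ[ℂ] H) (μ : ℂ) :
          Submodule ℂ H) := by
        rintro ⟨v, hv⟩
        refine Submodule.iSup_induction _ (motive := fun v => ∃ τ : ℝ, σ ^ 2 < τ ∧
          v ∈ (⨆ μ : {μ : ℝ // τ ≤ μ}, eigenspace (A : H →ₗ[ℂ] H) (μ : ℂ) :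
          Submodule ℂ H)) hv ?_ ?_ ?_
        · intro μ x hx
          exact ⟨μ, μ.2, le_iSup (fun ν : {ν : ℝ // (μ : ℝ) ≤ ν} =>
            eigenspace (A : H →ₗ[ℂ] H) (ν : ℂ)) ⟨μ, le_rfl⟩ hx⟩
        · exact ⟨σ ^ 2 + 1, by linarith, zero_mem _⟩
        · rintro x y ⟨a, ha, hx⟩ ⟨b, hb, hy⟩
          exact ⟨min a b, lt_min ha hb,
            add_mem (hanti _ _ (min_le_left _ _) hx) (hanti _ _ (min_le_right _ _) hy)⟩
      choose t ht htm using hex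
      have hne : s.Nonempty := by
        rw [← Finset.card_pos, hs]; omega
      refine ⟨s.inf' hne t, by simpa [Finset.lt_inf'_iff] using fun a ha _ => ht _, ?_⟩
      let w : s → (⨆ μ : {μ : ℝ // s.inf' hne t ≤ μ}, eigenspace (A : H →ₗ[ℂ] H) (μ : ℂ) :
          Submodule ℂ H) := fun v => ⟨(v : V), hanti _ _ (Finset.inf'_le _ v.2) (htm v)⟩
      have hw : LinearIndependent ℂ w := by
        refine LinearIndependent.of_comp (Submodule.subtype _) ?_
        exact hli.map' V.subtype (Submodule.ker_subtype _)
      have := hw.cardinal_le_rank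
      rw [Cardinal.mk_coe_finset, hs] at this
      refine lt_of_lt_of_le ?_ this
      exact_mod_cast Nat.lt_succ_self n
    have hτ0 : 0 ≤ τ := (sq_nonneg σ).trans hτ.le
    have hquad : ∀ x ∈ (⨆ μ : {μ : ℝ // τ ≤ μ}, eigenspace (A : H →ₗ[ℂ] H) (μ : ℂ) :
        Submodule ℂ H), Real.sqrt τ * ‖x‖ ≤ ‖T x‖ := by
      intro x hx
      classical
      have horth := hsymm.orthogonalFamily_eigenspaces.comp
        (f := fun μ : {μ : ℝ // τ ≤ μ} => ((μ : ℝ) : ℂ))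
        (fun a b hab => Subtype.ext (Complex.ofReal_injective hab))
      obtain ⟨l, rfl⟩ := (Submodule.mem_iSup_iff_exists_dfinsupp' _ _).1 hx
      have e1 : (‖l.sum fun _ v => (v : H)‖ : ℝ) ^ 2 = ∑ μ ∈ l.support, ‖l μ‖ ^ 2 := by
        exact horth.norm_sum l l.support
      have e2 : (‖T (l.sum fun _ v => (v : H))‖ : ℝ) ^ 2 =
          ∑ μ ∈ l.support, (μ : ℝ) * ‖l μ‖ ^ 2 := by
        have h0 : ((‖T (l.sum fun _ v => (v : H))‖ : ℝ) ^ 2 : ℂ) =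
            ∑ μ ∈ l.support, (μ : ℂ) * (‖l μ‖ : ℂ) ^ 2 := by
          have h3 : A (l.sum fun _ v => (v : H)) =
              ∑ μ ∈ l.support, (((μ : ℂ) • l μ : eigenspace (A : H →ₗ[ℂ] H) (μ : ℂ)) : H) := by
            rw [DFinsupp.sum, map_sum]
            refine Finset.sum_congr rfl fun μ _ => ?_
            exact mem_eigenspace_iff.1 (l μ).2
          have h4 := horth.inner_sum (fun μ => (μ : ℂ) • l μ) l l.support
          refine (inner_self_eq_norm_sq_to_K (𝕜 := ℂ) (T (l.sum fun _ v => (v : H)))).symm.trans ?_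
          rw [← hin, h3]
          refine h4.trans (Finset.sum_congr rfl fun μ _ => ?_)
          rw [inner_smul_left, inner_self_eq_norm_sq_to_K]
          simp
        exact_mod_cast h0
      rw [← sq_le_sq₀ (by positivity) (norm_nonneg _), mul_pow, Real.sq_sqrt hτ0, e2, e1,
        Finset.mul_sum]
      exact Finset.sum_le_sum fun μ _ => mul_le_mul_of_nonneg_right μ.2 (sq_nonneg _)
    have hlow : ENNReal.ofReal (Real.sqrt τ) ≤ singularValue ((T : H →ₗ[ℂ] H).toPMap D) n := by
      refine le_iInf₂ fun F hF => ?_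
      by_contra hlt
      push Not at hlt
      obtain ⟨c, hc0, hc1, hc2⟩ : ∃ c : ℝ, 0 ≤ c ∧ c < Real.sqrt τ ∧
          (⨆ (x : ((T : H →ₗ[ℂ] H).toPMap D).domain) (_ : ‖(x : H)‖ ≤ 1),
            ‖(T : H →ₗ[ℂ] H).toPMap D x - F x‖ₑ) ≤ ENNReal.ofReal c := by
        refine ⟨_, ENNReal.toReal_nonneg, ?_, (ENNReal.ofReal_toReal hlt.ne_top).ge⟩
        exact (ENNReal.lt_ofReal_iff_toReal_lt hlt.ne_top).1 hlt
      rw [iSup_enorm_le_iff T F D hD c hc0] at hc2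
      let G := (F : H →ₗ[ℂ] H).comp (⨆ μ : {μ : ℝ // τ ≤ μ},
        eigenspace (A : H →ₗ[ℂ] H) (μ : ℂ) : Submodule ℂ H).subtype
      have hG : ¬ Function.Injective G := by
        intro hinj
        have h5 := (rank_range_of_injective G hinj).symm
        have h6 : G.rank ≤ (F : H →ₗ[ℂ] H).rank := LinearMap.rank_comp_le_left _ _
        exact absurd (h5.le.trans (h6.trans hF)) (not_le.2 hτr)
      rw [← LinearMap.ker_eq_bot, Submodule.eq_bot_iff] at hG
      push Not at hG
      obtain ⟨x, hx, hx0⟩ := hG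
      have hFx : F (x : H) = 0 := hx
      have h7 := hc2 x
      rw [hFx, sub_zero] at h7
      have h8 := hquad x x.2
      have h9 : 0 < ‖(x : H)‖ := norm_pos_iff.2 (by simpa using hx0)
      nlinarith
    have h10 := hlow.trans h
    rw [ENNReal.ofReal_le_ofReal_iff hσ, Real.sqrt_le_left hσ] at h10
    linarith
  · intro hrank
    have hfin : FiniteDimensional ℂ V :=
      Module.rank_lt_aleph0_iff.1 (hrank.trans_lt (Cardinal.natCast_lt_aleph0))
    have hinv : ∀ x ∈ Vᗮ, (A : H →ₗ[ℂ] H) x ∈ Vᗮ := by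
      intro x hx
      rw [Submodule.mem_orthogonal'] at hx ⊢
      intro u hu
      have hu' : (A : H →ₗ[ℂ] H) u ∈ V := by
        refine Submodule.iSup_induction _ (motive := fun u => (A : H →ₗ[ℂ] H) u ∈ V) hu ?_ ?_ ?_
        · intro μ y hy
          rw [mem_eigenspace_iff.1 hy]
          exact V.smul_mem _ (le_iSup (fun μ : {μ : ℝ // σ ^ 2 < μ} =>
            eigenspace (A : H →ₗ[ℂ] H) (μ : ℂ)) μ hy)
        · simp
        · intro a b ha hb
          rw [map_add]
          exact V.add_mem ha hb
      rw [hsymm]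
      exact hx _ hu'
    let S : Vᗮ →L[ℂ] Vᗮ := A.restrict hinv
    have hSc : IsCompactOperator S := hcomp.restrict' hinv
    have hSs : (S : Vᗮ →ₗ[ℂ] Vᗮ).IsSymmetric := hsymm.restrict_invariant hinv
    have hSn : ‖S‖ ≤ σ ^ 2 := by
      have h1 : (‖S‖₊ : ℝ≥0∞) ≤ ENNReal.ofReal (σ ^ 2) := by
        rw [← S.spectralRadius_eq_nnnorm hSs.isSelfAdjoint]
        refine iSup₂_le fun μ hμ => ?_
        rcases eq_or_ne μ 0 with rfl | hμ0
        · simp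
        have hev := (hSc.hasEigenvalue_iff_mem_spectrum hμ0).2 hμ
        obtain ⟨y, hy⟩ := hev.exists_hasEigenvector
        have hreal := hSs.conj_eigenvalue_eq_self hev
        obtain ⟨r, rfl⟩ := Complex.conj_eq_iff_real.1 hreal
        have hAy : A (y : H) = (r : ℂ) • (y : H) := congrArg Subtype.val hy.apply_eq_smul
        have hy0 : (y : H) ≠ 0 := by simpa using hy.2
        have hr : r ≤ σ ^ 2 := by
          by_contra hlt
          push Not at hlt
          have hyV : (y : H) ∈ V := le_iSup (fun μ : {μ : ℝ // σ ^ 2 < μ} =>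
            eigenspace (A : H →ₗ[ℂ] H) (μ : ℂ)) ⟨r, hlt⟩ (mem_eigenspace_iff.2 hAy)
          exact hy0 (inner_self_eq_zero.1 ((Submodule.mem_orthogonal _ _).1 y.2 _ hyV))
        have hr0 : 0 ≤ r := by
          have h2 := hin (y : H) (y : H)
          rw [hAy, inner_smul_left, inner_self_eq_norm_sq_to_K, inner_self_eq_norm_sq_to_K] at h2
          simp only [Complex.conj_ofReal, Complex.coe_algebraMap] at h2
          have h3 : r * ‖(y : H)‖ ^ 2 = ‖T (y : H)‖ ^ 2 := by exact_mod_cast h2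
          have h4 : 0 < ‖(y : H)‖ ^ 2 := by positivity
          by_contra hneg
          push Not at hneg
          nlinarith [sq_nonneg ‖T (y : H)‖]
        rw [← ENNReal.ofReal_coe_nnreal, coe_nnnorm, Complex.norm_real, Real.norm_of_nonneg hr0]
        exact ENNReal.ofReal_le_ofReal hr
      rwa [← ENNReal.ofReal_coe_nnreal, ENNReal.ofReal_le_ofReal_iff (sq_nonneg _)] at h1
    have hperp : ∀ y ∈ Vᗮ, ‖T y‖ ≤ σ * ‖y‖ := by
      intro y hy
      have h1 : ‖T y‖ ^ 2 ≤ (σ * ‖y‖) ^ 2 := by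
        have h2 : ‖T y‖ ^ 2 = ‖⟪A y, y⟫_ℂ‖ := by
          rw [hin, inner_self_eq_norm_sq_to_K]
          simp
        have h3 : ‖A y‖ ≤ σ ^ 2 * ‖y‖ := by
          have := (S.le_opNorm ⟨y, hy⟩).trans (mul_le_mul_of_nonneg_right hSn (norm_nonneg _))
          exact this
        rw [h2]
        refine (norm_inner_le_norm _ _).trans ?_
        nlinarith [norm_nonneg y]
      exact (sq_le_sq₀ (norm_nonneg _) (by positivity)).1 h1
    refine iInf₂_le_of_le (T ∘L V.starProjection) ?_ ?_
    · refine le_trans ?_ hrank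
      refine (LinearMap.rank_comp_le_right _ _).trans ?_
      refine Submodule.rank_mono ?_
      rintro _ ⟨x, rfl⟩
      exact Submodule.starProjection_apply_mem V x
    · rw [iSup_enorm_le_iff _ _ D hD σ hσ]
      intro x
      have h1 := hperp _ (Submodule.sub_starProjection_mem_orthogonal (K := V) x)
      rw [map_sub] at h1
      refine h1.trans (mul_le_mul_of_nonneg_left ?_ hσ)
      rw [← Submodule.starProjection_orthogonal_val]
      exact Submodule.norm_starProjection_apply_le _ _

end CZCommutator

end

/-! Between functions with separated supports the commutator acts through the kernel
k(x-y)(f(y)-f(x)). Fix w ≠ 0 with k(-w) ≠ 0 and test the commutator on bumps of size ℓ centred at a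
and at a+ℓw. After rescaling and normalization, the matrix element is an average of
k(u-v-w)(f(a+ℓ(v+w))-f(a+ℓu)) over small u, v. For smooth f this is close to ℓ k(-w) ∂_w f(a). When
a runs through a lattice of spacing ℓ the bumps have disjoint supports, so a bounded region provides
about N = ℓ^(-d) matrix elements of size ℓ = N^(-1/d) between orthogonal families. If their sum has
no cancellation, the first N singular values add up to at least a constant times N^(1-1/d), which
contradicts the vanishing lower limit.

Since f need not be smooth, the matrix elements are weighted by a test function η and summed over
the lattice, and the lattice is then averaged over its shifts. This turns the sum into an integral
over a, and by Fubini only the smooth function P(z) = ∫ η(a) f(a+z) da enters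
(`integral_mul_bumpElement`). Its expansion at 0 (`exists_norm_kernel_mul_sub_le`) gives a lower
bound unless ∂_w P(0) = 0. Thus ∂_w P(0) = 0 for every η and for all w in a nonempty open set. By
linearity the whole derivative vanishes, and f is constant because all its regularizations are.

Two further ingredients are needed. The first is `enorm_sum_inner_le_sum_singularValue`: the sum of
matrix elements is the trace of an N×N matrix, and the trace is computed in an orthonormal basis
whose vectors are killed by the finite-rank approximants. Only the definition of singular values by
approximation is used, and the operator may be unbounded.

The second is that bumps lie in the natural domain of the commutator, that is, fφ and f·Kφ are
square integrable. As Kφ decays like |x|^(-d), this follows from an L² bound for f on balls whose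
means grow at most logarithmically with the radius (`memLp_mul_of_decay`). The L² bound is a weak
form of the John–Nirenberg inequality: a stopping-time argument halves any a priori bound up to an
additive constant, and iterating it on truncations removes the a priori bound. -/

open scoped ComplexConjugate

namespace CZCommutator

universe u

/-! ### Traces and singular values -/

/-- Given maps `F n` of rank at most `n` on an `N`-dimensional space, there is an orthonormal
family `u` of `m ≤ N` vectors such that `F (N - 1 - i)` kills `u i`. -/
theorem exists_orthonormal_mem_ker {V : Type*} [NormedAddCommGroup V] [InnerProductSpace ℂ V]
    [FiniteDimensional ℂ V] {N : ℕ} (hN : Module.finrank ℂ V = N) (F : ℕ → V →ₗ[ℂ] V)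
    (hF : ∀ n < N, (F n).rank ≤ n) (m : ℕ) (hm : m ≤ N) :
    ∃ u : Fin m → V, Orthonormal ℂ u ∧ ∀ i : Fin m, F (N - 1 - i) (u i) = 0 := by
  induction m with
  | zero => exact ⟨Fin.elim0, ⟨fun i => i.elim0, fun i => i.elim0⟩, fun i => i.elim0⟩
  | succ m ih =>
    obtain ⟨u, hu, hFu⟩ := ih (by omega)
    set n := N - 1 - m with hn
    let G : LinearMap.ker (F n) →ₗ[ℂ] (Fin m → ℂ) :=
      (LinearMap.pi fun i => (innerₛₗ ℂ (u i))).comp (LinearMap.ker (F n)).subtype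
    have hrank : Module.finrank ℂ (LinearMap.range (F n)) ≤ n := by
      have h := hF n (by omega)
      rw [LinearMap.rank, ← Module.finrank_eq_rank] at h
      exact_mod_cast h
    have hdim := LinearMap.finrank_range_add_finrank_ker (F n)
    -- The kernel of `F n` has dimension at least N - n = m + 1, while orthogonality to the earlier
    -- vectors imposes only m conditions.
    have hG : LinearMap.ker G ≠ ⊥ := by
      apply LinearMap.ker_ne_bot_of_finrank_lt
      rw [Module.finrank_fin_fun]
      omega
    obtain ⟨x, hx, hx0⟩ := Submodule.exists_mem_ne_zero_of_ne_bot hG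
    have hx1 : F n (x : V) = 0 := x.2
    have hx2 : ∀ i, ⟪u i, (x : V)⟫_ℂ = 0 := fun i => congrFun (LinearMap.mem_ker.1 hx) i
    have hxn : ‖(x : V)‖ ≠ 0 := by simpa using hx0
    refine ⟨Fin.snoc u (((‖(x : V)‖⁻¹ : ℝ) : ℂ) • (x : V)), ?_, ?_⟩
    · constructor
      · intro i
        refine Fin.lastCases ?_ (fun j => ?_) i
        · simp [norm_smul, hxn]
        · simpa using hu.1 j
      · intro i j
        refine Fin.lastCases ?_ (fun i' => ?_) i <;> refine Fin.lastCases ?_ (fun j' => ?_) j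
        · simp
        · intro _
          simp only [Fin.snoc_last, Fin.snoc_castSucc]
          rw [inner_smul_left, ← inner_conj_symm, hx2]
          simp
        · intro _
          simp only [Fin.snoc_last, Fin.snoc_castSucc]
          rw [inner_smul_right, hx2, mul_zero]
        · intro hij
          simp only [Fin.snoc_castSucc]
          exact hu.2 fun h => hij (by rw [h])
    · intro i
      refine Fin.lastCases ?_ (fun j => ?_) i
      · simp only [Fin.snoc_last, Fin.val_last, map_smul]
        rw [← hn, hx1, smul_zero]
      · simpa using hFu j

/-- Bessel-type bound for linear combinations of an orthogonal family. -/
theorem norm_sum_smul_le_of_orthogonal {H : Type*} [NormedAddCommGroup H] [InnerProductSpace ℂ H]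
    {ι : Type*} [Fintype ι] (e : ι → H) (he : ∀ i j, i ≠ j → ⟪e i, e j⟫_ℂ = 0) {C : ℝ}
    (hC : 0 ≤ C) (heC : ∀ i, ‖e i‖ ≤ C) (x : EuclideanSpace ℂ ι) :
    ‖∑ i, x i • e i‖ ≤ C * ‖x‖ := by
  classical
  have h1 : (‖∑ i, x i • e i‖ : ℝ) ^ 2 = ∑ i, ‖x i‖ ^ 2 * ‖e i‖ ^ 2 := by
    have h0 : ((‖∑ i, x i • e i‖ : ℝ) ^ 2 : ℂ) = ∑ i, (‖x i‖ : ℂ) ^ 2 * (‖e i‖ : ℂ) ^ 2 := by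
      refine (inner_self_eq_norm_sq_to_K (𝕜 := ℂ) (∑ i, x i • e i)).symm.trans ?_
      rw [sum_inner]
      refine Finset.sum_congr rfl fun i _ => ?_
      rw [inner_sum, Finset.sum_eq_single i]
      · rw [inner_smul_left, inner_smul_right, inner_self_eq_norm_sq_to_K, ← mul_assoc,
          Complex.conj_mul']
        simp
      · intro j _ hj
        rw [inner_smul_left, inner_smul_right, he i j hj.symm]
        simp
      · simp
    exact_mod_cast h0
  rw [← sq_le_sq₀ (norm_nonneg _) (by positivity), h1, mul_pow, EuclideanSpace.norm_sq_eq,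
    Finset.mul_sum]
  refine Finset.sum_le_sum fun i _ => ?_
  rw [mul_comm (C ^ 2)]
  have := heC i
  gcongr

/-- A sum of matrix elements between two orthogonal families is controlled by the sum of the
singular values. -/
theorem enorm_sum_inner_le_sum_singularValue {H ι : Type u} [NormedAddCommGroup H]
    [InnerProductSpace ℂ H] (A : H →ₗ.[ℂ] H) [Fintype ι] (e : ι → A.domain)
    (g : ι → H) {C D : ℝ} (hC : 0 < C) (hD : 0 < D)
    (he : ∀ i j, i ≠ j → ⟪(e i : H), (e j : H)⟫_ℂ = 0) (hg : ∀ i j, i ≠ j → ⟪g i, g j⟫_ℂ = 0)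
    (heC : ∀ i, ‖(e i : H)‖ ≤ C) (hgD : ∀ i, ‖g i‖ ≤ D) :
    ‖∑ i, ⟪g i, A (e i)⟫_ℂ‖ₑ ≤
      ENNReal.ofReal (C * D) * ∑ n ∈ Finset.range (Fintype.card ι), singularValue A n := by
  classical
  set N := Fintype.card ι with hN
  by_cases hfin : ∀ n < N, singularValue A n ≠ ⊤
  swap
  · push Not at hfin
    obtain ⟨n, hn, htop⟩ := hfin
    rw [ENNReal.sum_eq_top.2 ⟨n, Finset.mem_range.2 hn, htop⟩, ENNReal.mul_top (by simp; positivity)]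
    exact le_top
  -- The loss `ε` is needed because the infimum defining a singular value need not be attained.
  have key : ∀ ε : ℝ, 0 < ε → ‖∑ i, ⟪g i, A (e i)⟫_ℂ‖ ≤
      C * D * ∑ n ∈ Finset.range N, ((singularValue A n).toReal + ε) := by
    intro ε hε
    have hex : ∀ n, ∃ F : H →L[ℂ] H, n < N → (F : H →ₗ[ℂ] H).rank ≤ n ∧
        ∀ x : A.domain, ‖A x - F x‖ ≤ ((singularValue A n).toReal + ε) * ‖(x : H)‖ := by
      intro n
      by_cases hn : n < N
      swap
      · exact ⟨0, fun h => absurd h hn⟩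
      have hlt : singularValue A n < ENNReal.ofReal ((singularValue A n).toReal + ε) := by
        rw [ENNReal.lt_ofReal_iff_toReal_lt (hfin n hn)]
        linarith
      conv_lhs at hlt => rw [singularValue]
      simp only [iInf_lt_iff] at hlt
      obtain ⟨F, hF, hlt⟩ := hlt
      refine ⟨F, fun _ => ⟨hF, fun x => ?_⟩⟩
      have hs : 0 ≤ (singularValue A n).toReal + ε := by positivity
      rcases eq_or_ne (x : H) 0 with h0 | h0
      · have : x = 0 := Subtype.ext h0
        subst this
        simp
      have hn : 0 < ‖(x : H)‖ := norm_pos_iff.2 h0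
      have h1 : ‖A ((‖(x : H)‖⁻¹ : ℂ) • x) - F (((‖(x : H)‖⁻¹ : ℂ) • x : A.domain) : H)‖ₑ ≤
          ENNReal.ofReal ((singularValue A n).toReal + ε) := by
        refine le_trans ?_ hlt.le
        refine le_iSup₂_of_le ((‖(x : H)‖⁻¹ : ℂ) • x) ?_ le_rfl
        simp [norm_smul, hn.ne']
      rw [← ofReal_norm, ENNReal.ofReal_le_ofReal_iff hs, LinearPMap.map_smul, Submodule.coe_smul,
        map_smul, ← smul_sub, norm_smul] at h1
      simp only [norm_inv, Complex.norm_real, norm_norm] at h1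
      rwa [inv_mul_le_iff₀ hn, mul_comm] at h1
    choose F hF using hex
    -- `Em` synthesizes from the family e and `Gm` takes coefficients against g, so `B` below has
    -- the matrix ⟪g i, A (e j)⟫ and its trace is the sum in question.
    let Em : EuclideanSpace ℂ ι →ₗ[ℂ] A.domain :=
      { toFun := fun x => ∑ i, x i • e i
        map_add' := fun x y => by simp [add_smul, Finset.sum_add_distrib]
        map_smul' := fun c x => by simp [mul_smul, Finset.smul_sum] }
    let Gm : H →ₗ[ℂ] EuclideanSpace ℂ ι :=
      { toFun := fun y => WithLp.toLp 2 fun i => ⟪g i, y⟫_ℂ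
        map_add' := fun x y => by ext i; simp
        map_smul' := fun c x => by ext i; simp }
    have hGm : ∀ (x : EuclideanSpace ℂ ι) (y : H), ⟪x, Gm y⟫_ℂ = ⟪∑ i, x i • g i, y⟫_ℂ := by
      intro x y
      rw [PiLp.inner_apply, sum_inner]
      refine Finset.sum_congr rfl fun i _ => ?_
      rw [inner_smul_left]
      simp [Gm, mul_comm]
    let B : EuclideanSpace ℂ ι →ₗ[ℂ] EuclideanSpace ℂ ι := Gm ∘ₗ A.toFun ∘ₗ Em
    let F' : ℕ → EuclideanSpace ℂ ι →ₗ[ℂ] EuclideanSpace ℂ ι := fun n => Gm ∘ₗ (F n : H →ₗ[ℂ] H) ∘ₗ A.domain.subtype ∘ₗ Em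
    -- The trace may be computed in any orthonormal basis. In this one the compressed approximant of
    -- rank at most N - 1 - i kills the i-th vector, so each singular value is used exactly once, in
    -- reverse order.
    obtain ⟨u, hu, hFu⟩ := exists_orthonormal_mem_ker (V := EuclideanSpace ℂ ι) (N := N)
      (by simp [hN]) F' (fun n hn => by
        refine (LinearMap.rank_comp_le_right _ _).trans ?_
        exact (LinearMap.rank_comp_le_left _ _).trans ((hF n hn).1)) N le_rfl
    have hcard : Fintype.card (Fin N) = Module.finrank ℂ (EuclideanSpace ℂ ι) := by simp [hN]
    let b : OrthonormalBasis (Fin N) ℂ (EuclideanSpace ℂ ι) := OrthonormalBasis.mk hu (by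
      rw [hu.linearIndependent.span_eq_top_of_card_eq_finrank' hcard])
    have htr1 : LinearMap.trace ℂ (EuclideanSpace ℂ ι) B = ∑ i, ⟪g i, A (e i)⟫_ℂ := by
      rw [LinearMap.trace_eq_sum_inner B (EuclideanSpace.basisFun ι ℂ)]
      refine Finset.sum_congr rfl fun i _ => ?_
      have h1 : Em (EuclideanSpace.basisFun ι ℂ i) = e i := by
        simp [Em, EuclideanSpace.basisFun_apply]
      have h2 : B (EuclideanSpace.basisFun ι ℂ i) = Gm (A (e i)) := by
        simp only [B, LinearMap.comp_apply, h1]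
        rfl
      rw [h2, hGm]
      congr 1
      simp [EuclideanSpace.basisFun_apply]
    have htr2 : LinearMap.trace ℂ (EuclideanSpace ℂ ι) B = ∑ i : Fin N, ⟪u i, B (u i)⟫_ℂ := by
      rw [LinearMap.trace_eq_sum_inner B b]
      simp [b]
    rw [← htr1, htr2, Finset.mul_sum]
    refine (norm_sum_le _ _).trans ?_
    rw [← Finset.sum_range_reflect, Finset.sum_range fun j =>
      C * D * ((singularValue A (N - 1 - j)).toReal + ε)]
    refine Finset.sum_le_sum fun i _ => ?_
    have hi : N - 1 - (i : ℕ) < N := by have := i.2; omega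
    -- Subtracting the approximant is free on this vector, and it replaces A by a difference of norm
    -- about s_(N-1-i).
    have h1 : ⟪u i, B (u i)⟫_ℂ = ⟪∑ j, u i j • g j, A (Em (u i)) - F (N - 1 - i) (Em (u i))⟫_ℂ := by
      rw [inner_sub_right, ← hGm, ← hGm]
      have : Gm (F (N - 1 - i) (Em (u i))) = 0 := hFu i
      rw [this, inner_zero_right, sub_zero]
      rfl
    have h2 : ‖∑ j, u i j • g j‖ ≤ D * ‖u i‖ :=
      norm_sum_smul_le_of_orthogonal g hg hD.le hgD (u i)
    have h3 : ‖(Em (u i) : H)‖ ≤ C * ‖u i‖ := by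
      have := norm_sum_smul_le_of_orthogonal (fun i => (e i : H)) he hC.le heC (u i)
      simpa [Em] using this
    rw [hu.1 i, mul_one] at h2 h3
    rw [h1]
    refine (norm_inner_le_norm _ _).trans ?_
    have h4 := (hF _ hi).2 (Em (u i))
    have hs : 0 ≤ (singularValue A (N - 1 - i)).toReal + ε := by positivity
    calc _ ≤ D * (((singularValue A (N - 1 - i)).toReal + ε) * C) := by
            gcongr
            exact h4.trans (by gcongr)
      _ = _ := by ring
  have hlim : ‖∑ i, ⟪g i, A (e i)⟫_ℂ‖ ≤
      C * D * ∑ n ∈ Finset.range N, (singularValue A n).toReal := by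
    have ht : Tendsto (fun ε : ℝ => C * D * ∑ n ∈ Finset.range N, ((singularValue A n).toReal + ε))
        (𝓝[>] 0) (𝓝 (C * D * ∑ n ∈ Finset.range N, ((singularValue A n).toReal + 0))) :=
      (Continuous.tendsto (by fun_prop) 0).mono_left nhdsWithin_le_nhds
    simp only [add_zero] at ht
    exact ge_of_tendsto ht (eventually_nhdsWithin_of_forall key)
  rw [← ENNReal.toReal_sum fun n hn => hfin n (Finset.mem_range.1 hn)] at hlim
  rw [← ofReal_norm, ← ENNReal.ofReal_toReal (a := ∑ n ∈ Finset.range N, singularValue A n)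
    (ENNReal.sum_ne_top.2 fun n hn => hfin n (Finset.mem_range.1 hn)),
    ← ENNReal.ofReal_mul (by positivity)]
  exact ENNReal.ofReal_le_ofReal hlim

/-! ### Square integrability of functions of bounded mean oscillation -/

theorem volume_real_ball {d : ℕ} (a : E d) {r : ℝ} (hr : 0 < r) :
    volume.real (Metric.ball a r) = r ^ d * volume.real (Metric.ball (0 : E d) 1) := by
  have h := Measure.addHaar_ball_mul_of_pos (volume : Measure (E d)) a hr 1
  rw [mul_one] at h
  rw [Measure.real, h, ENNReal.toReal_mul, finrank_euclideanSpace_fin,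
    ENNReal.toReal_ofReal (by positivity), Measure.real]

theorem volume_real_ball_pos {d : ℕ} (a : E d) {r : ℝ} (hr : 0 < r) :
    0 < volume.real (Metric.ball a r) :=
  ENNReal.toReal_pos (Metric.measure_ball_pos _ _ hr).ne' measure_ball_lt_top.ne

/-- The distance of a mean value from a constant is controlled by the mean distance. -/
theorem norm_setAverage_sub_mul_le {X G : Type*} [MeasurableSpace X] [NormedAddCommGroup G]
    [NormedSpace ℝ G] [CompleteSpace G] {μ : Measure X} {s : Set X} (hs : μ s ≠ 0) (hs' : μ s ≠ ⊤)
    {g : X → G} (hg : IntegrableOn g s μ) (c : G) :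
    ‖(⨍ x in s, g x ∂μ) - c‖ * μ.real s ≤ ∫ x in s, ‖g x - c‖ ∂μ := by
  have h0 : 0 < μ.real s := ENNReal.toReal_pos hs hs'
  have : (⨍ x in s, g x ∂μ) - c = (μ.real s)⁻¹ • ∫ x in s, (g x - c) ∂μ := by
    rw [integral_sub hg (integrableOn_const hs'), setAverage_eq, smul_sub, setIntegral_const,
      smul_smul, inv_mul_cancel₀ h0.ne', one_smul]
  rw [this, norm_smul, norm_inv, Real.norm_of_nonneg h0.le, mul_comm, mul_inv_cancel_left₀ h0.ne']
  exact norm_integral_le_integral_norm _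

/-- The oscillation about the larger mean, integrated over the smaller ball, is at most its integral
over the larger ball; dividing by the smaller volume costs the volume ratio q^d. -/
theorem norm_setAverage_sub_setAverage_le {d : ℕ} {G : Type*} [NormedAddCommGroup G]
    [NormedSpace ℝ G] [CompleteSpace G] {g : E d → G} (hg : LocallyIntegrable g) {D : ℝ}
    (hD : ∀ (a : E d) (r : ℝ), 0 < r → ∫ x in Metric.ball a r, ‖g x - ⨍ y in Metric.ball a r, g y‖ ≤
      D * volume.real (Metric.ball a r))
    {a b : E d} {r q : ℝ} (hr : 0 < r) (hq : 0 < q)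
    (hsub : Metric.ball a r ⊆ Metric.ball b (q * r)) :
    ‖(⨍ y in Metric.ball a r, g y) - ⨍ y in Metric.ball b (q * r), g y‖ ≤ q ^ d * D := by
  have h_int : ∀ a r, IntegrableOn g (Metric.ball a r) := fun a r =>
    (hg.integrableOn_isCompact (isCompact_closedBall a r)).mono_set Metric.ball_subset_closedBall
  have h1 := norm_setAverage_sub_mul_le (Metric.measure_ball_pos volume a hr).ne'
    measure_ball_lt_top.ne (h_int a r) (⨍ y in Metric.ball b (q * r), g y)
  have h2 : ∫ x in Metric.ball a r, ‖g x - ⨍ y in Metric.ball b (q * r), g y‖ ≤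
      ∫ x in Metric.ball b (q * r), ‖g x - ⨍ y in Metric.ball b (q * r), g y‖ :=
    setIntegral_mono_set ((h_int _ _).sub (integrableOn_const measure_ball_lt_top.ne)).norm
      (ae_of_all _ fun _ => norm_nonneg _) hsub.eventuallyLE
  have h3 := (h1.trans h2).trans (hD b (q * r) (by positivity))
  have h4 := volume_real_ball_pos a hr
  rw [volume_real_ball b (by positivity), mul_pow, mul_assoc, ← volume_real_ball a hr,
    ← mul_assoc, mul_comm D] at h3
  exact le_of_mul_le_mul_right h3 h4

/-- The constant in the improvement of the `L²` mean oscillation of a `BMO` function. -/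
noncomputable def oscConst (d : ℕ) : ℝ := 4 * 12 ^ d * (1 + 2 ^ d)

/-- Stopping-time improvement of an a priori bound `F` on the `L²` mean oscillation. -/
theorem setIntegral_sq_sub_average_le_of_bound {d : ℕ} {g : E d → ℝ} (hg : Measurable g) {M : ℝ}
    (hM : ∀ x, |g x| ≤ M) {D : ℝ} (hDpos : 0 < D)
    (hD : ∀ (a : E d) (r : ℝ), 0 < r → ∫ x in Metric.ball a r, ‖g x - ⨍ y in Metric.ball a r, g y‖ ≤
      D * volume.real (Metric.ball a r)) {F : ℝ} (hF0 : 0 ≤ F)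
    (hF : ∀ (a : E d) (r : ℝ), 0 < r → ∫ x in Metric.ball a r, (g x - ⨍ y in Metric.ball a r, g y) ^ 2
      ≤ F * volume.real (Metric.ball a r)) (x₀ : E d) {R : ℝ} (hR : 0 < R) :
    ∫ x in Metric.ball x₀ R, (g x - ⨍ y in Metric.ball x₀ R, g y) ^ 2 ≤
      (((oscConst d * D) ^ 2 + (oscConst d * D + 3 ^ d * D) ^ 2 / 2) + F / 2) *
        volume.real (Metric.ball x₀ R) := by
  -- The stopping level. Its factor 4·12^d(1+2^d) is chosen so that F enters the final estimate with
  -- coefficient exactly 1/2, see `hQe`; it also makes the initial scale R fall below the level.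
  set lam := oscConst d * D with hlam
  have hlampos : 0 < lam := by rw [hlam, oscConst]; positivity
  set c := ⨍ y in Metric.ball x₀ R, g y with hc
  set h : E d → ℝ := fun x => ‖g x - c‖ with hh
  have hhm : Measurable h := by fun_prop
  have hhb : ∀ x, ‖h x‖ ≤ M + |c| := fun x => by
    rw [hh, norm_norm]
    exact (norm_sub_le _ _).trans (add_le_add (hM x) le_rfl)
  have hgloc : LocallyIntegrable g := fun x => by
    refine ⟨Metric.ball x 1, Metric.ball_mem_nhds x one_pos, ?_⟩
    exact Measure.integrableOn_of_bounded measure_ball_lt_top.ne hg.aestronglyMeasurable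
      (M := M) (ae_of_all _ hM)
  have hh_int : ∀ a r, IntegrableOn h (Metric.ball a r) := fun a r =>
    Measure.integrableOn_of_bounded measure_ball_lt_top.ne hhm.aestronglyMeasurable
      (M := M + |c|) (ae_of_all _ hhb)
  have hh0 : ∀ x, 0 ≤ h x := fun x => norm_nonneg _
  set v := volume.real (Metric.ball x₀ R) with hv
  have hvpos : 0 < v := volume_real_ball_pos x₀ hR
  have hvol : ∀ (a : E d) (r q : ℝ), 0 < r → 0 < q →
      volume.real (Metric.ball a (q * r)) = q ^ d * volume.real (Metric.ball a r) := by
    intro a r q hr hq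
    rw [volume_real_ball a (by positivity), volume_real_ball a hr, mul_pow, mul_assoc]
  -- the mean of `h` on the double ball
  have hdouble : ∫ x in Metric.ball x₀ (2 * R), h x ≤ (1 + 2 ^ d) * 2 ^ d * D * v := by
    set c' := ⨍ y in Metric.ball x₀ (2 * R), g y with hc'
    have h1 : ‖c - c'‖ ≤ 2 ^ d * D := norm_setAverage_sub_setAverage_le hgloc hD hR two_pos
      (Metric.ball_subset_ball (by linarith))
    have h2 : ∀ x, h x ≤ ‖g x - c'‖ + 2 ^ d * D := fun x => by
      have : g x - c = (g x - c') - (c - c') := by ring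
      simp only [hh, this]
      exact (norm_sub_le _ _).trans (add_le_add le_rfl h1)
    have hi : IntegrableOn (fun x => ‖g x - c'‖) (Metric.ball x₀ (2 * R)) :=
      Measure.integrableOn_of_bounded measure_ball_lt_top.ne
        (by fun_prop) (M := M + |c'|) (ae_of_all _ fun x => by
          rw [norm_norm]
          exact (norm_sub_le _ _).trans (add_le_add (hM x) le_rfl))
    have h3 : ∫ x in Metric.ball x₀ (2 * R), h x ≤
        ∫ x in Metric.ball x₀ (2 * R), (‖g x - c'‖ + 2 ^ d * D) :=
      setIntegral_mono (hh_int _ _) (hi.add (integrableOn_const measure_ball_lt_top.ne)) h2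
    rw [integral_add hi (integrableOn_const measure_ball_lt_top.ne), setIntegral_const,
      smul_eq_mul] at h3
    have h4 := hD x₀ (2 * R) (by positivity)
    rw [hvol x₀ R 2 hR two_pos] at h3 h4
    calc _ ≤ _ := h3
      _ ≤ D * (2 ^ d * v) + 2 ^ d * v * (2 ^ d * D) := by gcongr
      _ = _ := by ring
  -- the bad points and their stopping radii
  set t : Set (E d) := {x | x ∈ Metric.ball x₀ R ∧ ∃ n : ℕ,
    lam * volume.real (Metric.ball x (R / 2 ^ n)) < ∫ y in Metric.ball x (R / 2 ^ n), h y} with ht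
  have hgood : ∀ᵐ x : E d, x ∈ Metric.ball x₀ R → x ∉ t → h x ≤ lam := by
    have hhl : LocallyIntegrable h := fun x =>
      ⟨Metric.ball x 1, Metric.ball_mem_nhds x one_pos, hh_int x 1⟩
    filter_upwards [(Besicovitch.vitaliFamily (volume : Measure (E d))).ae_tendsto_average hhl]
      with x hx hxR hxt
    have hx' := hx.comp (Besicovitch.tendsto_filterAt volume x)
    have hr0 : Tendsto (fun n : ℕ => R / 2 ^ n) atTop (𝓝[>] 0) := by
      refine tendsto_nhdsWithin_iff.2 ⟨?_, Eventually.of_forall fun n => by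
        simp only [Set.mem_Ioi]; positivity⟩
      have := (tendsto_pow_atTop_nhds_zero_of_lt_one (r := (1 / 2 : ℝ)) (by norm_num)
        (by norm_num)).const_mul R
      simpa [div_eq_mul_inv] using this
    refine le_of_tendsto (hx'.comp hr0) (Eventually.of_forall fun n => ?_)
    have hrn : 0 < R / 2 ^ n := by positivity
    have hae : (Metric.closedBall x (R / 2 ^ n) : Set (E d)) =ᵐ[volume]
        Metric.ball x (R / 2 ^ n) := by
      rw [← Metric.sphere_union_ball]
      exact union_ae_eq_right_of_ae_eq_empty
        (ae_eq_empty.2 (Measure.addHaar_sphere_of_ne_zero _ _ hrn.ne'))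
    simp only [Function.comp]
    rw [Measure.restrict_congr_set hae, setAverage_eq, smul_eq_mul,
      inv_mul_le_iff₀ (volume_real_ball_pos x hrn), mul_comm]
    by_contra hcon
    exact hxt ⟨hxR, n, not_le.1 hcon⟩
  -- The radius is the first R/2^n at which the mean exceeds the level. The scale n = 0 is excluded
  -- by the bound on the double ball, so the previous scale 2r exists and there the mean is still at
  -- most the level.
  have hrad : ∀ x ∈ t, ∃ r : ℝ, 0 < r ∧ r ≤ R / 2 ∧
      lam * volume.real (Metric.ball x r) < ∫ y in Metric.ball x r, h y ∧
      ∫ y in Metric.ball x (2 * r), h y ≤ lam * volume.real (Metric.ball x (2 * r)) := by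
    classical
    rintro x ⟨hxR, hex⟩
    have hn := Nat.find_spec hex
    set n := Nat.find hex with hndef
    have hn0 : n ≠ 0 := by
      intro h0
      rw [h0, pow_zero, div_one] at hn
      have h1 : ∫ y in Metric.ball x R, h y ≤ ∫ y in Metric.ball x₀ (2 * R), h y := by
        refine setIntegral_mono_set (hh_int _ _) (ae_of_all _ hh0) (LE.le.eventuallyLE ?_)
        refine Metric.ball_subset_ball' ?_
        have := Metric.mem_ball.1 hxR
        linarith
      have h2 : volume.real (Metric.ball x R) = v := by
        rw [hv, volume_real_ball x hR, volume_real_ball x₀ hR]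
      rw [h2] at hn
      have h3 := hn.trans_le (h1.trans hdouble)
      have h4 : (1 + 2 ^ d) * 2 ^ d * D ≤ lam := by
        have : (2 : ℝ) ^ d ≤ 12 ^ d := by gcongr; norm_num
        have h12 : (0 : ℝ) < 12 ^ d := by positivity
        have h5 : (1 + 2 ^ d) * (2 : ℝ) ^ d ≤ 4 * 12 ^ d * (1 + 2 ^ d) := by
          rw [mul_comm]
          gcongr
          linarith
        rw [hlam, oscConst]
        gcongr
      nlinarith
    obtain ⟨m, hm⟩ := Nat.exists_eq_succ_of_ne_zero hn0
    refine ⟨R / 2 ^ n, by positivity, ?_, hn, ?_⟩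
    · rw [hm, pow_succ]
      have : (1 : ℝ) ≤ 2 ^ m := one_le_pow₀ (by norm_num)
      gcongr
      linarith
    · have h1 := Nat.find_min hex (m := m) (by omega)
      have h2 : 2 * (R / 2 ^ n) = R / 2 ^ m := by rw [hm, pow_succ]; field_simp
      rw [h2]
      exact not_lt.1 h1
  have hrad : ∃ r : E d → ℝ, ∀ x ∈ t, 0 < r x ∧ r x ≤ R / 2 ∧
      lam * volume.real (Metric.ball x (r x)) < ∫ y in Metric.ball x (r x), h y ∧
      ∫ y in Metric.ball x (2 * r x), h y ≤ lam * volume.real (Metric.ball x (2 * r x)) := by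
    have : ∀ x, ∃ r : ℝ, x ∈ t → 0 < r ∧ r ≤ R / 2 ∧
      lam * volume.real (Metric.ball x r) < ∫ y in Metric.ball x r, h y ∧
      ∫ y in Metric.ball x (2 * r), h y ≤ lam * volume.real (Metric.ball x (2 * r)) := by
      intro x
      by_cases hx : x ∈ t
      · obtain ⟨r, hr⟩ := hrad x hx
        exact ⟨r, fun _ => hr⟩
      · exact ⟨0, fun h => absurd h hx⟩
    exact ⟨fun x => (this x).choose, fun x => (this x).choose_spec⟩
  obtain ⟨r, hr⟩ := hrad
  -- The selected closed balls are disjoint and their fivefold enlargements cover the bad set;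
  -- radius 6r is used below to work with open balls.
  obtain ⟨u, hut, hudisj, hucov⟩ := Vitali.exists_disjoint_subfamily_covering_enlargement_closedBall
    t (fun x => x) r (R / 2) (fun x hx => (hr x hx).2.1) 5 (by norm_num)
  have hucount : u.Countable := hudisj.countable_of_nonempty_interior fun a ha => by
    rw [interior_closedBall _ (hr a (hut ha)).1.ne']
    exact ⟨a, Metric.mem_ball_self (hr a (hut ha)).1⟩
  -- the square integral on the enlarged balls
  set Q := 2 * (F + (lam + 3 ^ d * D) ^ 2) * 6 ^ d * lam⁻¹ with hQ
  have hQ0 : 0 ≤ Q := by positivity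
  have hsq : ∀ b ∈ u, ∫⁻ x in Metric.ball b (6 * r b), ENNReal.ofReal (h x ^ 2) ≤
      ENNReal.ofReal Q * ∫⁻ x in Metric.ball b (r b), ENNReal.ofReal (h x) := by
    intro b hb
    obtain ⟨hr0, -, hr1, hr2⟩ := hr b (hut hb)
    have hsqint : ∀ (c' : ℝ), IntegrableOn (fun x => (g x - c') ^ 2) (Metric.ball b (6 * r b)) :=
      fun c' => Measure.integrableOn_of_bounded measure_ball_lt_top.ne
        (by fun_prop) (M := (M + |c'|) ^ 2) (ae_of_all _ fun x => by
          rw [norm_pow]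
          gcongr
          exact (norm_sub_le _ _).trans (add_le_add (hM x) le_rfl))
    have hsqh : IntegrableOn (fun x => h x ^ 2) (Metric.ball b (6 * r b)) := by
      refine (hsqint c).congr (ae_of_all _ fun x => ?_)
      simp [hh]
    rw [← ofReal_integral_eq_lintegral_ofReal hsqh (ae_of_all _ fun x => by positivity),
      ← ofReal_integral_eq_lintegral_ofReal (hh_int _ _) (ae_of_all _ hh0),
      ← ENNReal.ofReal_mul hQ0]
    refine ENNReal.ofReal_le_ofReal ?_
    set c₂ := ⨍ y in Metric.ball b (2 * r b), g y
    set c₆ := ⨍ y in Metric.ball b (6 * r b), g y with hc₆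
    -- The mean over the sixfold ball is compared with c through the ball of radius 2r: the stopping
    -- rule controls c₂ - c, and enlargement by the factor 3 controls c₂ - c₆.
    have e1 : ‖c₂ - c‖ ≤ lam := by
      have h1 := norm_setAverage_sub_mul_le (Metric.measure_ball_pos volume b
        (by positivity : 0 < 2 * r b)).ne' measure_ball_lt_top.ne
        ((hgloc.integrableOn_isCompact (isCompact_closedBall b (2 * r b))).mono_set
          Metric.ball_subset_closedBall) c
      exact le_of_mul_le_mul_right (h1.trans hr2) (volume_real_ball_pos b (by positivity))
    have e2 : ‖c₂ - c₆‖ ≤ 3 ^ d * D := by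
      have h6 : 6 * r b = 3 * (2 * r b) := by ring
      rw [hc₆, h6]
      exact norm_setAverage_sub_setAverage_le hgloc hD (by positivity) (by norm_num)
        (Metric.ball_subset_ball (by linarith))
    have e3 : |c₆ - c| ≤ lam + 3 ^ d * D := by
      have : c₆ - c = (c₂ - c) - (c₂ - c₆) := by ring
      rw [this]
      exact (norm_sub_le _ _).trans (add_le_add e1 e2)
    have e4 : ∀ x, h x ^ 2 ≤ 2 * (g x - c₆) ^ 2 + 2 * (lam + 3 ^ d * D) ^ 2 := by
      intro x
      have h1 : h x ^ 2 = ((g x - c₆) + (c₆ - c)) ^ 2 := by simp [hh]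
      have h2 : (c₆ - c) ^ 2 ≤ (lam + 3 ^ d * D) ^ 2 := sq_le_sq' (by linarith [abs_le.1 e3])
        (abs_le.1 e3).2
      rw [h1]
      nlinarith [sq_nonneg ((g x - c₆) - (c₆ - c))]
    have e5 : ∫ x in Metric.ball b (6 * r b), h x ^ 2 ≤
        ∫ x in Metric.ball b (6 * r b), (2 * (g x - c₆) ^ 2 + 2 * (lam + 3 ^ d * D) ^ 2) :=
      setIntegral_mono hsqh (((hsqint c₆).const_mul 2).add
        (integrableOn_const measure_ball_lt_top.ne)) e4
    rw [integral_add ((hsqint c₆).const_mul 2) (integrableOn_const measure_ball_lt_top.ne),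
      integral_const_mul, setIntegral_const, smul_eq_mul] at e5
    have e6 := hF b (6 * r b) (by positivity)
    rw [hvol b (r b) 6 hr0 (by norm_num)] at e5 e6
    set w := volume.real (Metric.ball b (r b))
    calc _ ≤ _ := e5
      _ ≤ 2 * (F * (6 ^ d * w)) + 6 ^ d * w * (2 * (lam + 3 ^ d * D) ^ 2) := by gcongr
      _ = Q * (lam * w) := by rw [hQ]; field_simp
      _ ≤ _ := by gcongr
  have hsum : ∑' b : u, ∫⁻ x in Metric.ball (b : E d) (r b), ENNReal.ofReal (h x) ≤
      ENNReal.ofReal ((1 + 2 ^ d) * 2 ^ d * D * v) := by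
    rw [← lintegral_biUnion hucount (fun _ _ => measurableSet_ball)
      (hudisj.mono fun a => Metric.ball_subset_closedBall)]
    refine le_trans ?_ (ENNReal.ofReal_le_ofReal hdouble)
    rw [ofReal_integral_eq_lintegral_ofReal (hh_int _ _) (ae_of_all _ hh0)]
    refine lintegral_mono_set (Set.iUnion₂_subset fun b hb => Metric.ball_subset_ball' ?_)
    have h1 := (hr b (hut hb)).2.1
    have h2 := Metric.mem_ball.1 (hut hb).1
    linarith
  -- Off the bad set h² is at most lam². On the enlarged balls `hsq` bounds the integral of h² by
  -- that of h over the selected balls, which are disjoint and lie in the double ball.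
  have hmain : ∫⁻ x in Metric.ball x₀ R, ENNReal.ofReal (h x ^ 2) ≤
      ENNReal.ofReal (lam ^ 2 * v + Q * ((1 + 2 ^ d) * 2 ^ d * D * v)) := by
    set A : Set (E d) := {x | x ∈ Metric.ball x₀ R ∧ h x ≤ lam}
    have hAm : MeasurableSet A := measurableSet_ball.inter (measurableSet_le hhm measurable_const)
    have hcov : (Metric.ball x₀ R : Set (E d)) ≤ᵐ[volume]
        (A ∪ ⋃ b : u, Metric.ball (b : E d) (6 * r b) : Set (E d)) := by
      filter_upwards [hgood] with x hx hxR
      by_cases hxt : x ∈ t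
      · right
        obtain ⟨b, hb, hsub⟩ := hucov x hxt
        refine Set.mem_iUnion.2 ⟨⟨b, hb⟩, ?_⟩
        have h1 := hsub (Metric.mem_closedBall_self (hr x hxt).1.le)
        have h2 := (hr b (hut hb)).1
        exact Metric.closedBall_subset_ball (by linarith) h1
      · left
        exact ⟨hxR, hx hxR hxt⟩
    have : Countable u := hucount
    calc _ ≤ ∫⁻ x in (A ∪ ⋃ b : u, Metric.ball (b : E d) (6 * r b)), ENNReal.ofReal (h x ^ 2) :=
          lintegral_mono' (Measure.restrict_mono_ae hcov) le_rfl
      _ ≤ (∫⁻ x in A, ENNReal.ofReal (h x ^ 2)) +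
          ∫⁻ x in ⋃ b : u, Metric.ball (b : E d) (6 * r b), ENNReal.ofReal (h x ^ 2) :=
          lintegral_union_le _ _ _
      _ ≤ ENNReal.ofReal (lam ^ 2 * v) + ∑' b : u, ENNReal.ofReal Q *
          ∫⁻ x in Metric.ball (b : E d) (r b), ENNReal.ofReal (h x) := by
          gcongr
          · calc _ ≤ ∫⁻ x in A, ENNReal.ofReal (lam ^ 2) := by
                  refine setLIntegral_mono measurable_const fun x hx => ?_
                  refine ENNReal.ofReal_le_ofReal ?_
                  have := hh0 x
                  have := hx.2
                  gcongr
              _ = ENNReal.ofReal (lam ^ 2) * volume A := setLIntegral_const _ _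
              _ ≤ ENNReal.ofReal (lam ^ 2) * volume (Metric.ball x₀ R) := by
                  gcongr
                  exact fun x hx => hx.1
              _ = _ := by
                  rw [ENNReal.ofReal_mul (by positivity), hv, Measure.real,
                    ENNReal.ofReal_toReal measure_ball_lt_top.ne]
          · refine (lintegral_iUnion_le _ _).trans ?_
            exact ENNReal.tsum_le_tsum fun b => hsq b b.2
      _ ≤ _ := by
          rw [ENNReal.tsum_mul_left, ENNReal.ofReal_add (by positivity) (by positivity),
            ENNReal.ofReal_mul (p := Q) hQ0]
          gcongr
  have hfin : ∫ x in Metric.ball x₀ R, h x ^ 2 ≤ lam ^ 2 * v + Q * ((1 + 2 ^ d) * 2 ^ d * D * v) := by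
    have hi : IntegrableOn (fun x => h x ^ 2) (Metric.ball x₀ R) :=
      Measure.integrableOn_of_bounded measure_ball_lt_top.ne
        (by fun_prop) (M := (M + |c|) ^ 2) (ae_of_all _ fun x => by
          rw [norm_pow]
          gcongr
          exact hhb x)
    rw [← ofReal_integral_eq_lintegral_ofReal hi (ae_of_all _ fun x => by positivity),
      ENNReal.ofReal_le_ofReal_iff (by positivity)] at hmain
    exact hmain
  have hQe : Q * ((1 + 2 ^ d) * 2 ^ d * D * v) = (F + (lam + 3 ^ d * D) ^ 2) / 2 * v := by
    have h12 : (12 : ℝ) ^ d = 6 ^ d * 2 ^ d := by rw [← mul_pow]; norm_num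
    have hl : lam⁻¹ * ((1 + 2 ^ d) * (6 ^ d * 2 ^ d) * D) = 1 / 4 := by
      rw [hlam, oscConst, h12]
      field_simp
    calc _ = 2 * (F + (lam + 3 ^ d * D) ^ 2) * (lam⁻¹ * ((1 + 2 ^ d) * (6 ^ d * 2 ^ d) * D)) * v := by
            rw [hQ]; ring
      _ = _ := by rw [hl]; ring
  rw [hQe] at hfin
  calc _ = ∫ x in Metric.ball x₀ R, h x ^ 2 := by simp [hh]
    _ ≤ _ := hfin
    _ = _ := by ring

/-- One improvement step sends an a priori bound F to X + F/2, whose fixed point is 2X. Starting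
from the trivial bound 4M² and iterating, the dependence on M disappears, so the estimate survives
the removal of a truncation. -/
theorem setIntegral_sq_sub_average_le {d : ℕ} {g : E d → ℝ} (hg : Measurable g) {M : ℝ}
    (hM : ∀ x, |g x| ≤ M) {D : ℝ} (hDpos : 0 < D)
    (hD : ∀ (a : E d) (r : ℝ), 0 < r → ∫ x in Metric.ball a r, ‖g x - ⨍ y in Metric.ball a r, g y‖ ≤
      D * volume.real (Metric.ball a r)) (a : E d) {r : ℝ} (hr : 0 < r) :
    ∫ x in Metric.ball a r, (g x - ⨍ y in Metric.ball a r, g y) ^ 2 ≤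
      2 * ((oscConst d * D) ^ 2 + (oscConst d * D + 3 ^ d * D) ^ 2 / 2) *
        volume.real (Metric.ball a r) := by
  set X := (oscConst d * D) ^ 2 + (oscConst d * D + 3 ^ d * D) ^ 2 / 2 with hX
  have hX0 : 0 ≤ X := by positivity
  have hind : ∀ n : ℕ, ∀ (a : E d) (r : ℝ), 0 < r →
      ∫ x in Metric.ball a r, (g x - ⨍ y in Metric.ball a r, g y) ^ 2 ≤
        (2 * X + 4 * M ^ 2 / 2 ^ n) * volume.real (Metric.ball a r) := by
    intro n
    induction n with
    | zero =>
      intro a r hr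
      have hgi : IntegrableOn g (Metric.ball a r) :=
        Measure.integrableOn_of_bounded measure_ball_lt_top.ne hg.aestronglyMeasurable
          (M := M) (ae_of_all _ hM)
      set c := ⨍ y in Metric.ball a r, g y
      have hc : |c| ≤ M := by
        have h1 := norm_setAverage_sub_mul_le (Metric.measure_ball_pos volume a hr).ne'
          measure_ball_lt_top.ne hgi 0
        have h2 : ∫ x in Metric.ball a r, ‖g x - 0‖ ≤ ∫ _ in Metric.ball a r, M := by
          refine setIntegral_mono ?_ (integrableOn_const measure_ball_lt_top.ne) fun x => ?_
          · simp only [sub_zero]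
            exact hgi.norm
          · simpa using hM x
        rw [setIntegral_const, smul_eq_mul, mul_comm] at h2
        have h3 := le_of_mul_le_mul_right (h1.trans h2) (volume_real_ball_pos a hr)
        simpa using h3
      have h1 : ∀ x, (g x - c) ^ 2 ≤ 4 * M ^ 2 := fun x => by
        have h2 : |g x - c| ≤ 2 * M := (abs_sub _ _).trans (by linarith [hM x])
        rw [← sq_abs]
        have : 4 * M ^ 2 = (2 * M) ^ 2 := by ring
        rw [this]
        gcongr
      have h3 : ∫ x in Metric.ball a r, (g x - c) ^ 2 ≤ ∫ _ in Metric.ball a r, 4 * M ^ 2 := by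
        refine setIntegral_mono ?_ (integrableOn_const measure_ball_lt_top.ne) h1
        exact Measure.integrableOn_of_bounded measure_ball_lt_top.ne (by fun_prop)
          (M := 4 * M ^ 2) (ae_of_all _ fun x => by
            rw [Real.norm_of_nonneg (sq_nonneg _)]; exact h1 x)
      rw [setIntegral_const, smul_eq_mul, mul_comm] at h3
      refine h3.trans ?_
      gcongr
      simp only [pow_zero, div_one]
      linarith
    | succ n ih =>
      intro a r hr
      refine (setIntegral_sq_sub_average_le_of_bound hg hM hDpos hD (by positivity) ih a hr).trans
        (le_of_eq ?_)
      rw [← hX, pow_succ]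
      field_simp
      ring
  have hlim : Tendsto (fun n : ℕ => (2 * X + 4 * M ^ 2 / 2 ^ n) * volume.real (Metric.ball a r)) atTop
      (𝓝 ((2 * X + 0) * volume.real (Metric.ball a r))) := by
    refine Tendsto.mul_const _ (tendsto_const_nhds.add ?_)
    have := (tendsto_pow_atTop_nhds_zero_of_lt_one (r := (1 / 2 : ℝ)) (by norm_num)
        (by norm_num)).const_mul (4 * M ^ 2)
    simpa [div_eq_mul_inv] using this
  rw [add_zero] at hlim
  exact ge_of_tendsto hlim (Eventually.of_forall fun n => hind n a r hr)

/-- Composition with a `1`-Lipschitz function at most doubles the mean oscillation. -/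
theorem setIntegral_norm_comp_sub_average_le {d : ℕ} {f : E d → ℂ} (hf : LocallyIntegrable f)
    {B : ℝ} (hB : ∀ (a : E d) (r : ℝ), 0 < r →
      ∫ x in Metric.ball a r, ‖f x - ⨍ y in Metric.ball a r, f y‖ ≤ B * volume.real (Metric.ball a r))
    {Ψ : ℂ → ℝ} (hΨ : ∀ z w, |Ψ z - Ψ w| ≤ ‖z - w‖) (hΨf : LocallyIntegrable fun x => Ψ (f x))
    (a : E d) (r : ℝ) (hr : 0 < r) :
    ∫ x in Metric.ball a r, ‖Ψ (f x) - ⨍ y in Metric.ball a r, Ψ (f y)‖ ≤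
      2 * B * volume.real (Metric.ball a r) := by
  have h_int : ∀ {G : Type} [NormedAddCommGroup G] {g : E d → G}, LocallyIntegrable g →
      IntegrableOn g (Metric.ball a r) := fun hg =>
    (hg.integrableOn_isCompact (isCompact_closedBall a r)).mono_set Metric.ball_subset_closedBall
  have hfin : volume (Metric.ball a r) ≠ ⊤ := measure_ball_lt_top.ne
  set c := ⨍ y in Metric.ball a r, f y
  set m := ⨍ y in Metric.ball a r, Ψ (f y)
  have i1 : IntegrableOn (fun x => ‖Ψ (f x) - Ψ c‖) (Metric.ball a r) :=
    ((h_int hΨf).sub (integrableOn_const hfin)).norm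
  have h1 := norm_setAverage_sub_mul_le (Metric.measure_ball_pos volume a hr).ne' hfin
    (h_int hΨf) (Ψ c)
  have h2 : ∫ x in Metric.ball a r, ‖Ψ (f x) - Ψ c‖ ≤ ∫ x in Metric.ball a r, ‖f x - c‖ :=
    setIntegral_mono i1 ((h_int hf).sub (integrableOn_const hfin)).norm fun x => hΨ _ _
  have h3 : ∫ x in Metric.ball a r, ‖Ψ (f x) - m‖ ≤
      ∫ x in Metric.ball a r, (‖Ψ (f x) - Ψ c‖ + ‖m - Ψ c‖) := by
    refine setIntegral_mono ((h_int hΨf).sub (integrableOn_const hfin)).norm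
      (i1.add (integrableOn_const hfin)) fun x => ?_
    have : Ψ (f x) - m = (Ψ (f x) - Ψ c) - (m - Ψ c) := by ring
    simp only [this]
    exact norm_sub_le _ _
  rw [integral_add i1 (integrableOn_const hfin), setIntegral_const, smul_eq_mul] at h3
  have h4 := hB a r hr
  linarith

theorem exists_setIntegral_norm_sub_average_le {d : ℕ} {f : E d → ℂ} (hf : MemBMO f) :
    ∃ B : ℝ, 0 < B ∧ ∀ (a : E d) (r : ℝ), 0 < r →
      ∫ x in Metric.ball a r, ‖f x - ⨍ y in Metric.ball a r, f y‖ ≤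
        B * volume.real (Metric.ball a r) := by
  refine ⟨(bmoSeminorm f).toReal + 1, by positivity, fun a r hr => ?_⟩
  have h1 : ENNReal.ofReal (meanOsc f a r) ≤ bmoSeminorm f :=
    le_iSup_of_le a (le_iSup₂_of_le r hr le_rfl)
  rw [ENNReal.ofReal_le_iff_le_toReal hf.2.ne, meanOsc, setAverage_eq, smul_eq_mul,
    inv_mul_le_iff₀ (volume_real_ball_pos a hr), mul_comm] at h1
  have := volume_real_ball_pos a hr
  nlinarith

/-- A function of bounded mean oscillation is square integrable on balls, with a bound in terms of
its mean value. -/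
theorem exists_lintegral_enorm_sq_le {d : ℕ} {f : E d → ℂ} (hf : MemBMO f) :
    ∃ C : ℝ, 0 ≤ C ∧ ∀ (a : E d) (r : ℝ), 0 < r →
      ∫⁻ x in Metric.ball a r, ‖f x‖ₑ ^ 2 ≤
        ENNReal.ofReal ((2 * C + 2 * (⨍ y in Metric.ball a r, ‖f y‖) ^ 2) *
          volume.real (Metric.ball a r)) := by
  -- A measurable representative makes the truncations below measurable.
  wlog hm : Measurable f generalizing f
  · obtain ⟨f', hf'm, hff'⟩ := hf.1.aestronglyMeasurable
    have hres : ∀ s : Set (E d), f =ᵐ[volume.restrict s] f' := fun s => ae_restrict_of_ae hff'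
    have hmean : ∀ a r, meanOsc f' a r = meanOsc f a r := by
      intro a r
      unfold meanOsc
      rw [average_congr (hres (Metric.ball a r))]
      refine average_congr ?_
      filter_upwards [hres (Metric.ball a r)] with x hx
      rw [hx]
    have hf'B : MemBMO f' := by
      refine ⟨hf.1.congr hff', ?_⟩
      have := hf.2
      unfold bmoSeminorm at this ⊢
      simpa only [hmean] using this
    obtain ⟨C, hC, h⟩ := this hf'B hf'm.measurable
    refine ⟨C, hC, fun a r hr => ?_⟩
    have e1 : ∫⁻ x in Metric.ball a r, ‖f x‖ₑ ^ 2 = ∫⁻ x in Metric.ball a r, ‖f' x‖ₑ ^ 2 := by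
      refine lintegral_congr_ae ?_
      filter_upwards [hres (Metric.ball a r)] with x hx
      rw [hx]
    have e2 : ⨍ y in Metric.ball a r, ‖f y‖ = ⨍ y in Metric.ball a r, ‖f' y‖ := by
      refine average_congr ?_
      filter_upwards [hres (Metric.ball a r)] with x hx
      rw [hx]
    rw [e1, e2]
    exact h a r hr
  obtain ⟨B, hB0, hB⟩ := exists_setIntegral_norm_sub_average_le hf
  -- Truncating |f| at height n is a 1-Lipschitz operation, so all truncations share the oscillation
  -- bound 2B; monotone convergence then removes n.
  set D := 2 * B with hD
  set C := 2 * ((oscConst d * D) ^ 2 + (oscConst d * D + 3 ^ d * D) ^ 2 / 2) with hC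
  refine ⟨C, by positivity, fun a r hr => ?_⟩
  have hfin : volume (Metric.ball a r) ≠ ⊤ := measure_ball_lt_top.ne
  have hfi : IntegrableOn f (Metric.ball a r) :=
    (hf.1.integrableOn_isCompact (isCompact_closedBall a r)).mono_set Metric.ball_subset_closedBall
  set A := ⨍ y in Metric.ball a r, ‖f y‖ with hA
  have hv := volume_real_ball_pos a hr
  have hn : ∀ n : ℕ, ∫⁻ x in Metric.ball a r, ENNReal.ofReal ((min ‖f x‖ n) ^ 2) ≤
      ENNReal.ofReal ((2 * C + 2 * A ^ 2) * volume.real (Metric.ball a r)) := by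
    intro n
    set g : E d → ℝ := fun x => min ‖f x‖ n with hg
    have hg0 : ∀ x, 0 ≤ g x := fun x => by positivity
    have hgm : Measurable g := by fun_prop
    have hgM : ∀ x, |g x| ≤ n := fun x => by
      rw [abs_of_nonneg (hg0 x)]; exact min_le_right _ _
    have hgi : ∀ a r, IntegrableOn g (Metric.ball a r) := fun a r =>
      Measure.integrableOn_of_bounded measure_ball_lt_top.ne hgm.aestronglyMeasurable
          (M := n) (ae_of_all _ hgM)
    have hgl : LocallyIntegrable g := fun x =>
      ⟨Metric.ball x 1, Metric.ball_mem_nhds x one_pos, hgi x 1⟩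
    have h1 := setIntegral_sq_sub_average_le hgm hgM (by positivity : 0 < D)
      (setIntegral_norm_comp_sub_average_le (Ψ := fun z => min ‖z‖ n) hf.1 hB (fun z w => by
        refine (abs_min_sub_min_le_max _ _ _ _).trans ?_
        simpa using abs_norm_sub_norm_le z w) hgl) a hr
    simp only [← hC] at h1
    change ∫ x in Metric.ball a r, (g x - ⨍ y in Metric.ball a r, g y) ^ 2 ≤ _ at h1
    set m := ⨍ y in Metric.ball a r, g y with hmdef
    have hmA : m ≤ A := by
      rw [hmdef, hA, setAverage_eq, setAverage_eq]
      refine smul_le_smul_of_nonneg_left ?_ (by positivity)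
      exact setIntegral_mono (hgi a r) hfi.norm fun x => min_le_left _ _
    have hm0 : 0 ≤ m := by
      rw [hmdef, setAverage_eq]
      exact smul_nonneg (by positivity) (integral_nonneg hg0)
    have hsqi : ∀ c : ℝ, IntegrableOn (fun x => (g x - c) ^ 2) (Metric.ball a r) := fun c =>
      Measure.integrableOn_of_bounded hfin (by fun_prop) (M := (n + |c|) ^ 2)
        (ae_of_all _ fun x => by
          rw [norm_pow]
          gcongr
          exact (norm_sub_le _ _).trans (add_le_add (hgM x) le_rfl))
    have hsq0 : IntegrableOn (fun x => g x ^ 2) (Metric.ball a r) := by simpa using hsqi 0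
    rw [← ofReal_integral_eq_lintegral_ofReal hsq0 (ae_of_all _ fun x => by positivity)]
    refine ENNReal.ofReal_le_ofReal ?_
    have h2 : ∫ x in Metric.ball a r, g x ^ 2 ≤
        ∫ x in Metric.ball a r, (2 * (g x - m) ^ 2 + 2 * A ^ 2) := by
      refine setIntegral_mono hsq0 (((hsqi m).const_mul 2).add (integrableOn_const hfin))
        fun x => ?_
      have : m ^ 2 ≤ A ^ 2 := by gcongr
      simp only
      nlinarith [sq_nonneg (g x - 2 * m)]
    rw [integral_add ((hsqi m).const_mul 2) (integrableOn_const hfin), integral_const_mul,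
      setIntegral_const, smul_eq_mul] at h2
    linarith
  have hlim : ∀ x, Tendsto (fun n : ℕ => ENNReal.ofReal ((min ‖f x‖ n) ^ 2)) atTop
      (𝓝 (‖f x‖ₑ ^ 2)) := by
    intro x
    obtain ⟨N, hN⟩ := exists_nat_ge ‖f x‖
    refine tendsto_const_nhds.congr' ?_
    filter_upwards [eventually_ge_atTop N] with n hn'
    have : ‖f x‖ ≤ n := hN.trans (by exact_mod_cast hn')
    rw [min_eq_left this, ENNReal.ofReal_pow (norm_nonneg _), ofReal_norm]
  have hmono : ∀ x, Monotone fun n : ℕ => ENNReal.ofReal ((min ‖f x‖ n) ^ 2) := by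
    intro x n m hnm
    have : (n : ℝ) ≤ m := by exact_mod_cast hnm
    simp only
    gcongr
  have ht := lintegral_tendsto_of_tendsto_of_monotone
    (μ := volume.restrict (Metric.ball a r)) (f := fun (n : ℕ) x => ENNReal.ofReal ((min ‖f x‖ n) ^ 2))
    (F := fun x => ‖f x‖ₑ ^ 2) (fun n => by fun_prop) (ae_of_all _ hmono) (ae_of_all _ hlim)
  exact le_of_tendsto' ht hn

/-- The product of a function in `BMO` with a function of decay `(1 + |x|)^(-d)` is in `L²`. -/
theorem memLp_mul_of_decay {d : ℕ} (hd : 1 ≤ d) {f : E d → ℂ} (hf : MemBMO f) {w : E d → ℂ}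
    (hw : AEStronglyMeasurable w) {C : ℝ} (hC : ∀ᵐ x, ‖w x‖ * (1 + ‖x‖) ^ d ≤ C) :
    MemLp (fun x => f x * w x) 2 volume := by
  wlog hC0 : 0 ≤ C generalizing C
  · exact this (C := |C|) (hC.mono fun x hx => hx.trans (le_abs_self C)) (abs_nonneg C)
  obtain ⟨B, hB0, hB⟩ := exists_setIntegral_norm_sub_average_le hf
  have hfn : LocallyIntegrable fun x => ‖f x‖ := fun x => by
    obtain ⟨s, hs, hi⟩ := hf.1 x
    exact ⟨s, hs, hi.norm⟩
  obtain ⟨C₁, hC₁, hsq⟩ := exists_lintegral_enorm_sq_le hf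
  set A : ℕ → ℝ := fun j => ⨍ y in Metric.ball (0 : E d) (2 ^ j), ‖f y‖ with hA
  have hA0 : ∀ j, 0 ≤ A j := fun j => by
    rw [hA]
    simp only [setAverage_eq]
    exact smul_nonneg (by positivity) (integral_nonneg fun _ => norm_nonneg _)
  set b := 2 ^ d * (2 * B) with hb
  -- Doubling the radius changes the mean of |f| by at most b, so the means grow at most linearly in
  -- the dyadic scale.
  have hAj : ∀ j : ℕ, A j ≤ A 0 + b * j := by
    intro j
    induction j with
    | zero => simp
    | succ j ih =>
      have h1 := norm_setAverage_sub_setAverage_le (g := fun x => ‖f x‖) hfn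
        (setIntegral_norm_comp_sub_average_le (Ψ := fun z => ‖z‖) hf.1 hB
          (fun z w => abs_norm_sub_norm_le z w) hfn)
        (a := 0) (b := 0) (r := 2 ^ j) (q := 2) (by positivity) two_pos
        (Metric.ball_subset_ball (by linarith [pow_pos (two_pos : (0 : ℝ) < 2) j]))
      rw [← pow_succ'] at h1
      have h2 := (abs_le.1 h1).1
      change -b ≤ A j - A (j + 1) at h2
      push_cast
      linarith
  set v := volume.real (Metric.ball (0 : E d) 1) with hv
  set T : ℕ → ℝ := fun j => (C * 2 ^ d) ^ 2 * v *
    ((2 * C₁ + 2 * (A 0 + b * j) ^ 2) * (1 / 2) ^ j) with hT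
  have hTs : Summable T := by
    refine Summable.mul_left _ ?_
    have s0 := summable_geometric_of_lt_one (r := (1 / 2 : ℝ)) (by norm_num) (by norm_num)
    have s1 := summable_pow_mul_geometric_of_norm_lt_one (R := ℝ) 1 (r := 1 / 2) (by norm_num)
    have s2 := summable_pow_mul_geometric_of_norm_lt_one (R := ℝ) 2 (r := 1 / 2) (by norm_num)
    refine (((s0.mul_left (2 * C₁ + 2 * A 0 ^ 2)).add (s1.mul_left (4 * A 0 * b))).add
      (s2.mul_left (2 * b ^ 2))).congr fun j => ?_
    ring
  have hT0 : ∀ j, 0 ≤ T j := fun j => by positivity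
  -- Essentially dyadic annuli: on the j-th set 1+|x| is at least 2^j/2, and for j = 0 that
  -- condition is void.
  set S : ℕ → Set (E d) := fun j => {x | x ∈ Metric.ball (0 : E d) (2 ^ j) ∧ 2 ^ j ≤ 2 * (1 + ‖x‖)}
    with hS
  have hSm : ∀ j, MeasurableSet (S j) := fun j =>
    measurableSet_ball.inter (measurableSet_le measurable_const
      (measurable_const.mul (measurable_const.add measurable_norm)))
  have hcov : ⋃ j, S j = Set.univ := by
    classical
    refine Set.eq_univ_of_forall fun x => ?_
    have hex : ∃ j : ℕ, ‖x‖ < 2 ^ j := pow_unbounded_of_one_lt _ one_lt_two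
    refine Set.mem_iUnion.2 ⟨Nat.find hex, by simpa using Nat.find_spec hex, ?_⟩
    rcases Nat.eq_zero_or_eq_succ_pred (Nat.find hex) with h0 | h0
    · rw [h0]
      have := norm_nonneg x
      norm_num
      linarith
    · have := Nat.find_min hex (m := (Nat.find hex).pred) (by omega)
      rw [h0, pow_succ]
      linarith
  have hpiece : ∀ j, ∫⁻ x in S j, ‖f x * w x‖ₑ ^ 2 ≤ ENNReal.ofReal (T j) := by
    intro j
    have hp : (0 : ℝ) < 2 ^ j := by positivity
    set W : ℝ := C * (2 / 2 ^ j) ^ d with hW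
    have hW0 : 0 ≤ W := by positivity
    have h1 : ∫⁻ x in S j, ‖f x * w x‖ₑ ^ 2 ≤
        ∫⁻ x in S j, ENNReal.ofReal (W ^ 2) * ‖f x‖ₑ ^ 2 := by
      refine lintegral_mono_ae ?_
      filter_upwards [ae_restrict_of_ae hC, ae_restrict_mem (hSm j)] with x hx hxS
      rw [enorm_mul, mul_pow, mul_comm, ENNReal.ofReal_pow hW0]
      gcongr
      rw [← ofReal_norm]
      refine ENNReal.ofReal_le_ofReal ?_
      have hx1 : 0 < 1 + ‖x‖ := by positivity
      have h2 : ‖w x‖ ≤ C / (1 + ‖x‖) ^ d := by rwa [le_div_iff₀ (by positivity)]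
      refine h2.trans ?_
      rw [hW, div_eq_mul_inv, ← inv_pow]
      gcongr
      rw [inv_le_comm₀ hx1 (by positivity), inv_div, div_le_iff₀ two_pos]
      linarith [hxS.2]
    have h2 : ∫⁻ x in S j, ENNReal.ofReal (W ^ 2) * ‖f x‖ₑ ^ 2 ≤
        ENNReal.ofReal (W ^ 2) * ∫⁻ x in Metric.ball (0 : E d) (2 ^ j), ‖f x‖ₑ ^ 2 := by
      rw [lintegral_const_mul' _ _ ENNReal.ofReal_ne_top]
      gcongr
      exact fun x hx => hx.1
    refine (h1.trans h2).trans ?_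
    refine (mul_le_mul_right (hsq 0 (2 ^ j) hp) _).trans ?_
    rw [← ENNReal.ofReal_mul (by positivity)]
    refine ENNReal.ofReal_le_ofReal ?_
    rw [volume_real_ball 0 hp, ← hv]
    have h3 := hAj j
    have h4 := hA0 j
    -- Decay squared gives 2^(-2jd) and the volume gives 2^(jd). As d ≥ 1, a geometric factor 2^(-j)
    -- remains to beat the quadratic growth in j.
    have hp1 : ((1 : ℝ) / 2 ^ j) ^ d ≤ (1 / 2) ^ j := by
      rw [one_div_pow (2 : ℝ) j]
      refine pow_le_of_le_one (by positivity) ?_ (by omega)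
      exact div_le_one_of_le₀ (one_le_pow₀ one_le_two) (by positivity)
    calc W ^ 2 * ((2 * C₁ + 2 * A j ^ 2) * ((2 ^ j) ^ d * v))
        = (C * 2 ^ d) ^ 2 * v * ((2 * C₁ + 2 * A j ^ 2) * (1 / 2 ^ j) ^ d) := by
          rw [hW, div_pow, div_pow, one_pow]
          field_simp
      _ ≤ T j := by
          rw [hT]
          simp only
          gcongr
  refine ⟨hf.1.aestronglyMeasurable.mul hw, ?_⟩
  rw [eLpNorm_lt_top_iff_lintegral_rpow_enorm_lt_top (by norm_num) (by norm_num)]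
  simp only [ENNReal.toReal_ofNat, ENNReal.rpow_ofNat]
  rw [← setLIntegral_univ, ← hcov]
  refine (lintegral_iUnion_le _ _).trans_lt ?_
  refine (ENNReal.tsum_le_tsum hpiece).trans_lt ?_
  rw [← ENNReal.ofReal_tsum_of_nonneg hT0 hTs]
  exact ENNReal.ofReal_lt_top

/-! ### Singular integrals of test functions -/

theorem IsCZKernel.exists_norm_le {d : ℕ} {k : E d → ℂ} (hk : IsCZKernel k) :
    ∃ C : ℝ, 0 ≤ C ∧ ∀ x : E d, x ≠ 0 → ‖k x‖ ≤ C * (‖x‖ ^ d)⁻¹ := by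
  have hcont : ContinuousOn k (Metric.sphere (0 : E d) 1) :=
    hk.smooth.continuousOn.mono fun x hx => by
      rw [Set.mem_compl_singleton_iff, ← norm_ne_zero_iff, mem_sphere_zero_iff_norm.1 hx]
      exact one_ne_zero
  obtain ⟨C, hC⟩ := (isCompact_sphere (0 : E d) 1).exists_bound_of_continuousOn hcont
  refine ⟨|C|, abs_nonneg C, fun x hx => ?_⟩
  have hn : 0 < ‖x‖ := norm_pos_iff.2 hx
  have h1 : x = ‖x‖ • (‖x‖⁻¹ • x) := by rw [smul_smul, mul_inv_cancel₀ hn.ne', one_smul]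
  have h2 : ‖‖x‖⁻¹ • x‖ = 1 := by
    rw [norm_smul, norm_inv, norm_norm, inv_mul_cancel₀ hn.ne']
  have h3 := hk.homogeneous ‖x‖ hn (‖x‖⁻¹ • x) (norm_ne_zero_iff.1 (by rw [h2]; exact one_ne_zero))
  rw [← h1] at h3
  rw [h3, norm_smul, norm_inv, norm_pow, norm_norm, mul_comm]
  gcongr
  exact (hC _ (by simpa using h2)).trans (le_abs_self C)

theorem IsCZKernel.measurable {d : ℕ} {k : E d → ℂ} (hk : IsCZKernel k) : Measurable k :=
  measurable_of_continuousOn_compl_singleton 0 hk.smooth.continuousOn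

/-- In polar coordinates each sphere contributes zero. -/
theorem IsCZKernel.setIntegral_annulus {d : ℕ} [Nontrivial (E d)] {k : E d → ℂ}
    (hk : IsCZKernel k) (ε R : ℝ) : ∫ z in {z : E d | ε < ‖z‖ ∧ ‖z‖ ≤ R}, k z = 0 := by
  have hms : MeasurableSet {z : E d | ε < ‖z‖ ∧ ‖z‖ ≤ R} :=
    (measurableSet_lt measurable_const measurable_norm).inter
      (measurableSet_le measurable_norm measurable_const)
  rw [← integral_indicator hms]
  set F := Set.indicator {z : E d | ε < ‖z‖ ∧ ‖z‖ ≤ R} k with hF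
  set ν := (volume : Measure (E d)).toSphere.prod
    (Measure.volumeIoiPow (Module.finrank ℝ (E d) - 1)) with hν
  set G : Metric.sphere (0 : E d) 1 × Set.Ioi (0 : ℝ) → ℂ :=
    fun p => F ((p.2 : ℝ) • (p.1 : E d)) with hG
  have h1 : ∫ x, F x = ∫ x : ({(0 : E d)}ᶜ : Set (E d)), F x.1 ∂(volume.comap Subtype.val) := by
    rw [integral_subtype_comap (measurableSet_singleton _).compl F, restrict_compl_singleton]
  have h2 : ∫ x : ({(0 : E d)}ᶜ : Set (E d)), F x.1 ∂(volume.comap Subtype.val) = ∫ p, G p ∂ν := by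
    rw [← (volume : Measure (E d)).measurePreserving_homeomorphUnitSphereProd.integral_comp
        (Homeomorph.measurableEmbedding _) G]
    refine integral_congr_ae (ae_of_all _ fun x => ?_)
    have hx : ‖(x : E d)‖ ≠ 0 := norm_ne_zero_iff.2 x.2
    simp [hG, smul_smul, hx]
  rw [h1, h2]
  -- Without integrability the integral is zero by convention, so no condition on ε and R is needed.
  by_cases hi : Integrable G ν
  swap
  · exact integral_undef hi
  rw [integral_prod_symm _ hi]
  refine integral_eq_zero_of_ae (ae_of_all _ fun r => ?_)
  have hr : 0 < (r : ℝ) := r.2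
  by_cases hr' : ε < (r : ℝ) ∧ (r : ℝ) ≤ R
  · have : ∀ θ : Metric.sphere (0 : E d) 1, G (θ, r) = k ((r : ℝ) • (θ : E d)) := fun θ => by
      rw [hG, hF]
      exact Set.indicator_of_mem (by simpa [norm_smul, abs_of_pos hr] using hr') _
    simp only [this, Pi.zero_apply]
    exact hk.mean_zero r hr
  · have : ∀ θ : Metric.sphere (0 : E d) 1, G (θ, r) = 0 := fun θ => by
      rw [hG, hF]
      exact Set.indicator_of_notMem (by simpa [norm_smul, abs_of_pos hr] using hr') _
    simp [this]

/-- The singularity |z|^(1-d), which is what cancellation leaves of the kernel, is exactly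
compensated by the Jacobian r^(d-1). -/
theorem integrableOn_inv_pow_mul_norm {d : ℕ} [Nontrivial (E d)] (R : ℝ) :
    IntegrableOn (fun z : E d => (‖z‖ ^ d)⁻¹ * ‖z‖) (Metric.ball 0 R) := by
  refine (integrableOn_fun_norm_addHaar volume (f := fun y : ℝ => (y ^ d)⁻¹ * y)).2 ?_
  have hd : Module.finrank ℝ (E d) = d := finrank_euclideanSpace_fin
  have hpos : 0 < Module.finrank ℝ (E d) := Module.finrank_pos
  rw [hd] at hpos ⊢
  refine (integrableOn_const (C := (1 : ℝ)) (s := Set.Ioo 0 R) (by simp)).congr_fun (fun y hy => ?_)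
    measurableSet_Ioo
  have hy : y ≠ 0 := hy.1.ne'
  obtain ⟨n, rfl⟩ := Nat.exists_eq_succ_of_ne_zero hpos.ne'
  simp only [Nat.succ_eq_add_one, Nat.add_sub_cancel, smul_eq_mul, pow_succ]
  field_simp

/-- The truncated singular integrals of a test function are uniformly bounded. -/
theorem IsCZKernel.exists_truncated_norm_le {d : ℕ} [Nontrivial (E d)] {k : E d → ℂ}
    (hk : IsCZKernel k) {φ : E d → ℂ} (hφ : ContDiff ℝ ∞ φ) (hφc : HasCompactSupport φ) :
    ∃ C : ℝ, ∀ (x : E d) (ε : ℝ), 0 < ε → ε < 1 →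
      ‖∫ y in {y : E d | ε < ‖x - y‖}, k (x - y) * φ y‖ ≤ C := by
  obtain ⟨C, hC0, hC⟩ := hk.exists_norm_le
  obtain ⟨Lφ, hLφ⟩ := ContDiff.lipschitzWith_of_hasCompactSupport hφc hφ (by simp)
  have hφi : Integrable φ := hφ.continuous.integrable_of_hasCompactSupport hφc
  refine ⟨(∫ z in Metric.ball (0 : E d) 2, C * Lφ * ((‖z‖ ^ d)⁻¹ * ‖z‖)) + C * ∫ y, ‖φ y‖,
    fun x ε hε hε1 => ?_⟩
  have hm1 : MeasurableSet {z : E d | ε < ‖z‖} := measurableSet_lt measurable_const measurable_norm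
  have hm2 : MeasurableSet {z : E d | ε < ‖z‖ ∧ ‖z‖ ≤ 1} :=
    hm1.inter (measurableSet_le measurable_norm measurable_const)
  have hm3 : MeasurableSet {z : E d | 1 < ‖z‖} := measurableSet_lt measurable_const measurable_norm
  have hkb : ∀ δ : ℝ, 0 < δ → ∀ z : E d, δ < ‖z‖ → ‖k z‖ ≤ C * (δ ^ d)⁻¹ := by
    intro δ hδ z hz
    refine (hC z (norm_pos_iff.1 (hδ.trans hz))).trans ?_
    gcongr
  have hm4 : MeasurableSet {y : E d | ε < ‖x - y‖} :=
    measurableSet_lt measurable_const (measurable_const.sub measurable_id).norm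
  have htr : ∫ y in {y : E d | ε < ‖x - y‖}, k (x - y) * φ y =
      ∫ z in {z : E d | ε < ‖z‖}, k z * φ (x - z) := by
    rw [← integral_indicator hm1, ← integral_indicator hm4, ← integral_sub_left_eq_self _ _ x]
    refine integral_congr_ae (ae_of_all _ fun y => ?_)
    simp [Set.indicator_apply]
  have hφx : Integrable fun z => φ (x - z) := hφi.comp_sub_left x
  have h_int : IntegrableOn (fun z => k z * φ (x - z)) {z : E d | ε < ‖z‖} := by
    refine Integrable.bdd_mul (c := C * (ε ^ d)⁻¹) hφx.integrableOn
      hk.measurable.aestronglyMeasurable ?_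
    filter_upwards [ae_restrict_mem hm1] with z hz using hkb ε hε z hz
  have hsplit : {z : E d | ε < ‖z‖} = {z : E d | ε < ‖z‖ ∧ ‖z‖ ≤ 1} ∪ {z : E d | 1 < ‖z‖} := by
    ext z
    simp only [Set.mem_ofPred_eq, Set.mem_union]
    constructor
    · intro h
      rcases le_or_gt ‖z‖ 1 with h1 | h1
      · exact Or.inl ⟨h, h1⟩
      · exact Or.inr h1
    · rintro (h | h)
      · exact h.1
      · exact hε1.trans h
  have hdisj : Disjoint {z : E d | ε < ‖z‖ ∧ ‖z‖ ≤ 1} {z : E d | 1 < ‖z‖} :=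
    Set.disjoint_left.2 fun z hz hz' => not_lt.2 hz.2 hz'
  have hi1 : IntegrableOn (fun z => k z * φ (x - z)) {z : E d | ε < ‖z‖ ∧ ‖z‖ ≤ 1} :=
    h_int.mono_set (fun z hz => hz.1)
  have hfin : volume {z : E d | ε < ‖z‖ ∧ ‖z‖ ≤ 1} ≠ ⊤ := by
    refine ((measure_mono ?_).trans_lt
      (measure_closedBall_lt_top (x := (0 : E d)) (r := 1))).ne
    intro z hz
    simpa using hz.2
  have hki : IntegrableOn k {z : E d | ε < ‖z‖ ∧ ‖z‖ ≤ 1} := by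
    refine Measure.integrableOn_of_bounded hfin hk.measurable.aestronglyMeasurable
      (M := C * (ε ^ d)⁻¹) ?_
    filter_upwards [ae_restrict_mem hm2] with z hz using hkb ε hε z hz.1
  -- Mean value zero allows φ(x) to be subtracted; the Lipschitz bound for φ then yields an
  -- integrable majorant independent of ε and x.
  have hzero : ∫ z in {z : E d | ε < ‖z‖ ∧ ‖z‖ ≤ 1}, k z * φ (x - z) =
      ∫ z in {z : E d | ε < ‖z‖ ∧ ‖z‖ ≤ 1}, k z * (φ (x - z) - φ x) := by
    simp only [mul_sub]
    rw [integral_sub hi1 (hki.mul_const _), integral_mul_const, hk.setIntegral_annulus, zero_mul,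
      sub_zero]
  rw [htr, hsplit, setIntegral_union hdisj hm3 hi1 (h_int.mono_set fun z hz => hε1.trans hz), hzero]
  refine (norm_add_le _ _).trans (add_le_add ?_ ?_)
  · have hib : IntegrableOn (fun z : E d => C * Lφ * ((‖z‖ ^ d)⁻¹ * ‖z‖)) (Metric.ball 0 2) :=
      (integrableOn_inv_pow_mul_norm (d := d) 2).const_mul (C * Lφ)
    have hsub : {z : E d | ε < ‖z‖ ∧ ‖z‖ ≤ 1} ⊆ Metric.ball 0 2 := fun z hz => by
      simpa using hz.2.trans_lt one_lt_two
    refine (norm_integral_le_of_norm_le (hib.mono_set hsub) ?_).trans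
      (setIntegral_mono_set hib (ae_of_all _ fun z => ?_) (LE.le.eventuallyLE hsub))
    · filter_upwards [ae_restrict_mem hm2] with z hz
      rw [norm_mul]
      have h1 := hC z (norm_pos_iff.1 (hε.trans hz.1))
      have h2 : ‖φ (x - z) - φ x‖ ≤ Lφ * ‖z‖ := by
        have := hLφ.norm_sub_le (x - z) x
        simpa using this
      calc _ ≤ (C * (‖z‖ ^ d)⁻¹) * (Lφ * ‖z‖) := by gcongr
        _ = _ := by ring
    · simp only [Pi.zero_apply]
      positivity
  · have h1 : ∫ y, ‖φ y‖ = ∫ z, ‖φ (x - z)‖ := (integral_sub_left_eq_self (fun y => ‖φ y‖) _ x).symm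
    rw [h1, ← integral_const_mul]
    refine (norm_integral_le_of_norm_le (hφx.norm.const_mul C).integrableOn ?_).trans
      (setIntegral_le_integral (hφx.norm.const_mul C) (ae_of_all _ fun z => ?_))
    · filter_upwards [ae_restrict_mem hm3] with z hz
      rw [norm_mul]
      have := hkb 1 one_pos z hz
      simp only [one_pow, inv_one, mul_one] at this
      gcongr
    · simp only [Pi.zero_apply]
      positivity

/-- A singular integral of a test function is bounded and decays like `|x|^(-d)`. -/
theorem exists_norm_singularIntegral_le {d : ℕ} (hd : 1 ≤ d) {k : E d → ℂ} (hk : IsCZKernel k)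
    {K : L2 d →L[ℂ] L2 d} (hK : IsSingularIntegral k K) {φ : E d → ℂ} (hφ : ContDiff ℝ ∞ φ)
    (hφc : HasCompactSupport φ) (hφ2 : MemLp φ 2 (volume : Measure (E d))) :
    ∃ C : ℝ, ∀ᵐ x, ‖K (hφ2.toLp φ) x‖ * (1 + ‖x‖) ^ d ≤ C := by
  have : Nontrivial (E d) := by
    have : Nonempty (Fin d) := ⟨⟨0, hd⟩⟩
    infer_instance
  obtain ⟨C, hC0, hC⟩ := hk.exists_norm_le
  obtain ⟨B, hB⟩ := hk.exists_truncated_norm_le hφ hφc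
  have hφi : Integrable φ := hφ.continuous.integrable_of_hasCompactSupport hφc
  obtain ⟨R, hR1, hR⟩ : ∃ R : ℝ, 1 ≤ R ∧ ∀ y, φ y ≠ 0 → ‖y‖ ≤ R := by
    obtain ⟨R, hR⟩ := hφc.isBounded.exists_norm_le
    exact ⟨max R 1, le_max_right _ _, fun y hy => (hR y (subset_tsupport φ hy)).trans
      (le_max_left _ _)⟩
  refine ⟨max (|B| * (1 + 2 * R) ^ d) (C * 4 ^ d * ∫ y, ‖φ y‖), ?_⟩
  filter_upwards [hK φ hφ hφc hφ2] with x hx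
  have hev : ∀ᶠ ε : ℝ in 𝓝[>] 0, 0 < ε ∧ ε < 1 := Ioo_mem_nhdsGT one_pos
  -- Near the support the uniform bound on truncations suffices. Away from it |x - y| ≥ |x|/2 on the
  -- support, and the size of the kernel gives the decay.
  rcases le_or_gt ‖x‖ (2 * R) with hxR | hxR
  · refine le_trans ?_ (le_max_left _ _)
    have h1 : ‖K (hφ2.toLp φ) x‖ ≤ |B| := by
      refine le_of_tendsto hx.norm ?_
      filter_upwards [hev] with ε hε
      exact (hB x ε hε.1 hε.2).trans (le_abs_self B)
    gcongr
  · refine le_trans ?_ (le_max_right _ _)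
    have hx0 : 0 < ‖x‖ := by linarith
    have h1 : ‖K (hφ2.toLp φ) x‖ ≤ C * (2 / ‖x‖) ^ d * ∫ y, ‖φ y‖ := by
      refine le_of_tendsto hx.norm ?_
      filter_upwards [hev] with ε hε
      rw [← integral_const_mul]
      refine (norm_integral_le_of_norm_le (hφi.norm.const_mul _).integrableOn ?_).trans
        (setIntegral_le_integral (hφi.norm.const_mul _) (ae_of_all _ fun z => by
          simp only [Pi.zero_apply]; positivity))
      refine ae_of_all _ fun y => ?_
      by_cases hy : φ y = 0
      · simp [hy]
      have hyR := hR y hy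
      have hxy : ‖x‖ / 2 ≤ ‖x - y‖ := by
        have := norm_sub_norm_le x y
        linarith
      have hxy0 : 0 < ‖x - y‖ := by linarith
      rw [norm_mul]
      gcongr
      refine (hC _ (norm_pos_iff.1 hxy0)).trans ?_
      rw [← inv_pow]
      gcongr
      rw [inv_le_comm₀ hxy0 (by positivity), inv_div]
      exact hxy
    have h2 : (1 + ‖x‖) ^ d ≤ (2 * ‖x‖) ^ d := by
      gcongr
      linarith
    have hI : 0 ≤ ∫ y, ‖φ y‖ := integral_nonneg fun _ => norm_nonneg _
    calc _ ≤ (C * (2 / ‖x‖) ^ d * ∫ y, ‖φ y‖) * (2 * ‖x‖) ^ d := by gcongr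
      _ = C * ((2 / ‖x‖) * (2 * ‖x‖)) ^ d * ∫ y, ‖φ y‖ := by
        rw [mul_pow (2 / ‖x‖)]; ring
      _ = _ := by
        congr 3
        field_simp
        norm_num

/-- Test functions are in the domain of the commutator with a function in `BMO`. -/
theorem toLp_mem_commutatorDomain {d : ℕ} (hd : 1 ≤ d) {k : E d → ℂ} (hk : IsCZKernel k)
    {K : L2 d →L[ℂ] L2 d} (hK : IsSingularIntegral k K) {f : E d → ℂ} (hf : MemBMO f)
    {φ : E d → ℂ} (hφ : ContDiff ℝ ∞ φ) (hφc : HasCompactSupport φ)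
    (hφ2 : MemLp φ 2 (volume : Measure (E d))) : hφ2.toLp φ ∈ commutatorDomain K f := by
  constructor
  · have hcont : Continuous fun x => ‖φ x‖ * (1 + ‖x‖) ^ d := by
      have := hφ.continuous
      fun_prop
    have hcs : HasCompactSupport fun x => ‖φ x‖ * (1 + ‖x‖) ^ d := hφc.norm.mul_right
    obtain ⟨C, hC⟩ := hcs.exists_bound_of_continuous hcont
    refine memLp_mul_of_decay (C := C) hd hf (Lp.aestronglyMeasurable _) ?_
    filter_upwards [hφ2.coeFn_toLp] with x hx
    rw [hx]
    exact (le_abs_self _).trans (hC x)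
  · obtain ⟨C, hC⟩ := exists_norm_singularIntegral_le hd hk hK hφ hφc hφ2
    exact memLp_mul_of_decay hd hf (Lp.aestronglyMeasurable _) hC

/-! ### Matrix elements of the commutator between functions with separated supports -/

/-- The kernel `k` cut off to `|z| ≥ ρ`. -/
noncomputable def cutKernel {d : ℕ} (k : E d → ℂ) (ρ : ℝ) : E d → ℂ := Set.indicator {z | ρ ≤ ‖z‖} k

theorem cutKernel_of_le {d : ℕ} (k : E d → ℂ) {ρ : ℝ} {z : E d} (hz : ρ ≤ ‖z‖) :
    cutKernel k ρ z = k z := Set.indicator_of_mem (s := {z : E d | ρ ≤ ‖z‖}) hz k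

theorem cutKernel_of_lt {d : ℕ} (k : E d → ℂ) {ρ : ℝ} {z : E d} (hz : ‖z‖ < ρ) :
    cutKernel k ρ z = 0 := Set.indicator_of_notMem (s := {z : E d | ρ ≤ ‖z‖}) (not_le.2 hz) k

theorem IsCZKernel.measurable_cutKernel {d : ℕ} {k : E d → ℂ} (hk : IsCZKernel k) (ρ : ℝ) :
    Measurable (cutKernel k ρ) :=
  hk.measurable.indicator (measurableSet_le measurable_const measurable_norm)

theorem IsCZKernel.exists_norm_cutKernel_le {d : ℕ} {k : E d → ℂ} (hk : IsCZKernel k) {ρ : ℝ}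
    (hρ : 0 < ρ) : ∃ C : ℝ, 0 ≤ C ∧ ∀ z, ‖cutKernel k ρ z‖ ≤ C := by
  obtain ⟨C, hC0, hC⟩ := hk.exists_norm_le
  refine ⟨C * (ρ ^ d)⁻¹, by positivity, fun z => ?_⟩
  rcases le_or_gt ρ ‖z‖ with hz | hz
  · rw [cutKernel_of_le k hz]
    refine (hC z (norm_pos_iff.1 (hρ.trans_le hz))).trans ?_
    gcongr
  · rw [cutKernel_of_lt k hz, norm_zero]
    positivity

theorem IsCZKernel.cutKernel_smul {d : ℕ} {k : E d → ℂ} (hk : IsCZKernel k) {ρ t : ℝ}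
    (hρ : 0 < ρ) (ht : 0 < t) (z : E d) :
    cutKernel k (t * ρ) (t • z) = ((t ^ d)⁻¹ : ℝ) • cutKernel k ρ z := by
  have hn : ‖t • z‖ = t * ‖z‖ := by rw [norm_smul, Real.norm_of_nonneg ht.le]
  rcases le_or_gt ρ ‖z‖ with hz | hz
  · rw [cutKernel_of_le k hz, cutKernel_of_le k (by rw [hn]; gcongr),
      hk.homogeneous t ht z (norm_pos_iff.1 (hρ.trans_le hz))]
  · rw [cutKernel_of_lt k hz, cutKernel_of_lt k (by rw [hn]; gcongr), smul_zero]

theorem IsCZKernel.integrable_cutKernel_mul {d : ℕ} {k : E d → ℂ} (hk : IsCZKernel k) {ρ : ℝ}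
    (hρ : 0 < ρ) {g h : E d → ℂ} (hg : Integrable g) (hh : Integrable h) :
    Integrable (fun p : E d × E d => cutKernel k ρ (p.1 - p.2) * (g p.1 * h p.2))
      (volume.prod volume) := by
  obtain ⟨C, -, hC⟩ := hk.exists_norm_cutKernel_le hρ
  refine Integrable.bdd_mul (c := C) (hg.mul_prod hh) ?_ (ae_of_all _ fun p => hC _)
  exact ((hk.measurable_cutKernel ρ).comp
    (measurable_fst.sub measurable_snd)).aestronglyMeasurable

/-- When x has distance at least ρ from the points where φ ≠ 0, the truncated integrals do not
depend on ε < ρ, and the principal value is an ordinary integral. -/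
theorem singularIntegral_eq_of_separated {d : ℕ} {k : E d → ℂ} {K : L2 d →L[ℂ] L2 d}
    (hK : IsSingularIntegral k K) {φ : E d → ℂ} (hφ : ContDiff ℝ ∞ φ)
    (hφc : HasCompactSupport φ) (hφ2 : MemLp φ 2 (volume : Measure (E d))) {ρ : ℝ} (hρ : 0 < ρ) :
    ∀ᵐ x, (∀ y, φ y ≠ 0 → ρ ≤ ‖x - y‖) →
      K (hφ2.toLp φ) x = ∫ y, cutKernel k ρ (x - y) * φ y := by
  filter_upwards [hK φ hφ hφc hφ2] with x hx hsep
  refine tendsto_nhds_unique hx (tendsto_const_nhds.congr' ?_)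
  filter_upwards [Ioo_mem_nhdsGT hρ] with ε hε
  have hm : MeasurableSet {y : E d | ε < ‖x - y‖} :=
    measurableSet_lt measurable_const (measurable_const.sub measurable_id).norm
  rw [← integral_indicator hm]
  refine integral_congr_ae (ae_of_all _ fun y => ?_)
  by_cases hy : φ y = 0
  · simp [hy, Set.indicator_apply]
  · have h1 := hsep y hy
    simp only
    rw [cutKernel_of_le k h1, Set.indicator_of_mem (s := {y : E d | ε < ‖x - y‖})
      (hε.2.trans_le h1)]

/-- The kernel formula for K is given only on test functions, whereas the commutator applies K to
the product fe, which need not be smooth. Moving K to the other side avoids this: the adjoint is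
identified on U by pairing it with test functions supported in U. -/
theorem adjoint_singularIntegral_eq_of_separated {d : ℕ} {k : E d → ℂ} (hk : IsCZKernel k)
    {K : L2 d →L[ℂ] L2 d} (hK : IsSingularIntegral k K) {g : E d → ℂ} (hg : Continuous g)
    (hgc : HasCompactSupport g) (hg2 : MemLp g 2 (volume : Measure (E d))) {ρ : ℝ} (hρ : 0 < ρ)
    {U : Set (E d)} (hU : IsOpen U) (hsep : ∀ x, g x ≠ 0 → ∀ y ∈ U, ρ ≤ ‖x - y‖) :
    ∀ᵐ y, y ∈ U → conj (ContinuousLinearMap.adjoint K (hg2.toLp g) y) =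
      ∫ x, cutKernel k ρ (x - y) * conj (g x) := by
  set G := ContinuousLinearMap.adjoint K (hg2.toLp g) with hG
  set J : E d → ℂ := fun y => ∫ x, cutKernel k ρ (x - y) * conj (g x) with hJ
  have hgi : Integrable fun x => conj (g x) :=
    (Complex.continuous_conj.comp hg).integrable_of_hasCompactSupport
      (hgc.comp_left (map_zero _))
  obtain ⟨C, -, hC⟩ := hk.exists_norm_cutKernel_le hρ
  have hJm : StronglyMeasurable J := by
    have : StronglyMeasurable (fun p : E d × E d => cutKernel k ρ (p.2 - p.1) * conj (g p.2)) := by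
      refine Measurable.stronglyMeasurable (Measurable.mul ?_ ?_)
      · exact (hk.measurable_cutKernel ρ).comp (measurable_snd.sub measurable_fst)
      · exact (Complex.continuous_conj.comp hg).measurable.comp measurable_snd
    exact this.integral_prod_right
  have hJb : ∀ y, ‖J y‖ ≤ ∫ x, C * ‖conj (g x)‖ := fun y => by
    refine norm_integral_le_of_norm_le (hgi.norm.const_mul C) (ae_of_all _ fun x => ?_)
    rw [norm_mul]
    gcongr
    exact hC _
  have hJl : LocallyIntegrable J := fun y =>
    ⟨Metric.ball y 1, Metric.ball_mem_nhds y one_pos,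
      Measure.integrableOn_of_bounded measure_ball_lt_top.ne hJm.aestronglyMeasurable
        (ae_of_all _ hJb)⟩
  have hGl : LocallyIntegrable (fun y => conj (G y)) := by
    have h1 : MemLp (fun y => conj (G y)) 2 (volume : Measure (E d)) := (Lp.memLp G).star
    exact h1.locallyIntegrable (by norm_num)
  have hmain := hU.ae_eq_zero_of_integral_contDiff_smul_eq_zero
    (μ := volume) (f := fun y => conj (G y) - J y) ((hGl.sub hJl).locallyIntegrableOn U) ?_
  · filter_upwards [hmain] with y hy hyU
    exact sub_eq_zero.1 (hy hyU)
  intro ψ hψ hψc hψU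
  set ψc : E d → ℂ := fun y => (ψ y : ℂ) with hψcdef
  have hψs : ContDiff ℝ ∞ ψc := Complex.ofRealCLM.contDiff.comp hψ
  have hψcs : HasCompactSupport ψc := hψc.comp_left (g := Complex.ofReal) Complex.ofReal_zero
  have hψ2 : MemLp ψc 2 (volume : Measure (E d)) :=
    hψs.continuous.memLp_of_hasCompactSupport hψcs
  have hψi : Integrable ψc := hψs.continuous.integrable_of_hasCompactSupport hψcs
  have e1 : ∫ y, ψ y • conj (G y) = ⟪G, hψ2.toLp ψc⟫_ℂ := by
    rw [L2.inner_def]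
    refine integral_congr_ae ?_
    filter_upwards [hψ2.coeFn_toLp] with y hy
    rw [hy, RCLike.inner_apply, Complex.real_smul]
  have e2 : ⟪G, hψ2.toLp ψc⟫_ℂ = ∫ x, (∫ y, cutKernel k ρ (x - y) * ψc y) * conj (g x) := by
    rw [hG, ContinuousLinearMap.adjoint_inner_left, L2.inner_def]
    refine integral_congr_ae ?_
    filter_upwards [hg2.coeFn_toLp, singularIntegral_eq_of_separated hK hψs hψcs hψ2 hρ]
      with x hx hKx
    rw [hx, RCLike.inner_apply]
    by_cases hgx : g x = 0
    · simp [hgx]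
    · rw [hKx fun y hy => hsep x hgx y (hψU (subset_tsupport ψ fun h => hy (by simp [hψcdef, h])))]
  have h_int := hk.integrable_cutKernel_mul hρ hgi hψi
  have e3 : ∫ x, (∫ y, cutKernel k ρ (x - y) * ψc y) * conj (g x) =
      ∫ y, ψ y • J y := by
    calc _ = ∫ x, ∫ y, cutKernel k ρ (x - y) * (conj (g x) * ψc y) := by
          refine integral_congr_ae (ae_of_all _ fun x => ?_)
          simp only
          rw [← integral_mul_const]
          refine integral_congr_ae (ae_of_all _ fun y => ?_)
          simp only
          ring
      _ = ∫ y, ∫ x, cutKernel k ρ (x - y) * (conj (g x) * ψc y) := integral_integral_swap h_int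
      _ = _ := by
          refine integral_congr_ae (ae_of_all _ fun y => ?_)
          simp only [hJ, Complex.real_smul]
          rw [← integral_const_mul]
          refine integral_congr_ae (ae_of_all _ fun x => ?_)
          simp only [hψcdef]
          ring
  have i1 : Integrable fun y => ψ y • conj (G y) :=
    hGl.integrable_smul_left_of_hasCompactSupport hψ.continuous hψc
  have i2 : Integrable fun y => ψ y • J y :=
    hJl.integrable_smul_left_of_hasCompactSupport hψ.continuous hψc
  simp only [smul_sub]
  rw [integral_sub i1 i2, e1, e2, e3, sub_self]

/-- Both terms become double integrals against the same bounded cut-off kernel, the first through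
the adjoint and the second directly; subtraction produces the factor f(y) - f(x). -/
theorem inner_commutator_eq {d : ℕ} {k : E d → ℂ} (hk : IsCZKernel k)
    {K : L2 d →L[ℂ] L2 d} (hK : IsSingularIntegral k K) {f f' : E d → ℂ}
    (hf : LocallyIntegrable f) (hff' : f =ᵐ[volume] f')
    {e g : E d → ℂ} (he : ContDiff ℝ ∞ e) (hec : HasCompactSupport e)
    (he2 : MemLp e 2 (volume : Measure (E d))) (hed : he2.toLp e ∈ commutatorDomain K f)
    (hg : Continuous g) (hgc : HasCompactSupport g) (hg2 : MemLp g 2 (volume : Measure (E d)))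
    {ρ : ℝ} (hρ : 0 < ρ) {U : Set (E d)} (hU : IsOpen U) (heU : ∀ y, e y ≠ 0 → y ∈ U)
    (hsep : ∀ x, g x ≠ 0 → ∀ y ∈ U, ρ ≤ ‖x - y‖) :
    ⟪hg2.toLp g, commutator K f ⟨he2.toLp e, hed⟩⟫_ℂ =
      ∫ p : E d × E d, cutKernel k ρ (p.1 - p.2) * (f' p.2 - f' p.1) * (e p.2 * conj (g p.1)) := by
  have hf' : LocallyIntegrable f' := hf.congr hff'
  have hgcc : Continuous fun x => conj (g x) := Complex.continuous_conj.comp hg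
  have hgccs : HasCompactSupport fun x => conj (g x) := hgc.comp_left (map_zero _)
  have hgi : Integrable fun x => conj (g x) := hgcc.integrable_of_hasCompactSupport hgccs
  have hei : Integrable e := he.continuous.integrable_of_hasCompactSupport hec
  have hfe : Integrable fun y => f' y * e y := by
    have := hf'.integrable_smul_left_of_hasCompactSupport he.continuous hec
    refine this.congr (ae_of_all _ fun y => ?_)
    simp [mul_comm]
  have hfg : Integrable fun x => f' x * conj (g x) := by
    have := hf'.integrable_smul_left_of_hasCompactSupport hgcc hgccs
    refine this.congr (ae_of_all _ fun y => ?_)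
    simp [mul_comm]
  have hcomm : commutator K f ⟨he2.toLp e, hed⟩ = K (hed.1.toLp _) - hed.2.toLp _ := rfl
  rw [hcomm, inner_sub_right]
  have hint1 := hk.integrable_cutKernel_mul hρ hgi hfe
  have hint2 := hk.integrable_cutKernel_mul hρ hfg hei
  have e1 : ⟪hg2.toLp g, K (hed.1.toLp _)⟫_ℂ =
      ∫ p : E d × E d, cutKernel k ρ (p.1 - p.2) * (conj (g p.1) * (f' p.2 * e p.2)) := by
    rw [← ContinuousLinearMap.adjoint_inner_left, L2.inner_def]
    calc _ = ∫ y, ∫ x, cutKernel k ρ (x - y) * (conj (g x) * (f' y * e y)) := by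
          refine integral_congr_ae ?_
          filter_upwards [hed.1.coeFn_toLp, he2.coeFn_toLp, hff',
            adjoint_singularIntegral_eq_of_separated hk hK hg hgc hg2 hρ hU hsep] with y h1 h2 h3 h4
          rw [h1, h2, h3, RCLike.inner_apply]
          by_cases hey : e y = 0
          · simp [hey]
          · rw [h4 (heU y hey), ← integral_const_mul]
            refine integral_congr_ae (ae_of_all _ fun x => ?_)
            simp only
            ring
      _ = _ := (integral_prod_symm _ hint1).symm
  have e2 : ⟪hg2.toLp g, hed.2.toLp _⟫_ℂ =
      ∫ p : E d × E d, cutKernel k ρ (p.1 - p.2) * ((f' p.1 * conj (g p.1)) * e p.2) := by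
    rw [L2.inner_def]
    calc _ = ∫ x, ∫ y, cutKernel k ρ (x - y) * ((f' x * conj (g x)) * e y) := by
          refine integral_congr_ae ?_
          filter_upwards [hed.2.coeFn_toLp, hg2.coeFn_toLp, hff',
            singularIntegral_eq_of_separated hK he hec he2 hρ] with x h1 h2 h3 h4
          rw [h1, h2, h3, RCLike.inner_apply]
          by_cases hgx : g x = 0
          · simp [hgx]
          · rw [h4 fun y hy => hsep x hgx y (heU y hy), mul_right_comm, ← integral_const_mul]
            refine integral_congr_ae (ae_of_all _ fun x => ?_)
            simp only
            ring
      _ = _ := (integral_prod _ hint2).symm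
  rw [e1, e2]
  refine (integral_sub hint1 hint2).symm.trans (integral_congr_ae (ae_of_all _ fun p => ?_))
  simp only
  ring

/-! ### Localized test functions -/

/-- The function `φ` moved to the point `a + ℓ w` and rescaled to size `ℓ`. -/
noncomputable def bumpAt {d : ℕ} (φ : E d → ℝ) (ℓ : ℝ) (w a : E d) : E d → ℂ :=
  fun y => (φ (ℓ⁻¹ • (y - a) - w) : ℂ)

section bumpAt

variable {d : ℕ} {φ : E d → ℝ} {δ ℓ : ℝ}

theorem contDiff_bumpAt (hφ : ContDiff ℝ ∞ φ) (ℓ : ℝ) (w a : E d) :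
    ContDiff ℝ ∞ (bumpAt φ ℓ w a) := by
  refine Complex.ofRealCLM.contDiff.comp (hφ.comp ?_)
  fun_prop

theorem mem_ball_of_bumpAt_ne_zero (hφδ : ∀ y, φ y ≠ 0 → ‖y‖ < δ) (hℓ : 0 < ℓ) {w a y : E d}
    (hy : bumpAt φ ℓ w a y ≠ 0) : y ∈ Metric.ball (a + ℓ • w) (ℓ * δ) := by
  have h1 := hφδ (ℓ⁻¹ • (y - a) - w) (fun h => hy (by simp [bumpAt, h]))
  have h2 : y - (a + ℓ • w) = ℓ • (ℓ⁻¹ • (y - a) - w) := by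
    rw [smul_sub, smul_smul, mul_inv_cancel₀ hℓ.ne', one_smul, sub_sub]
  rw [mem_ball_iff_norm, h2, norm_smul, Real.norm_of_nonneg hℓ.le]
  gcongr

theorem hasCompactSupport_bumpAt (hφδ : ∀ y, φ y ≠ 0 → ‖y‖ < δ) (hℓ : 0 < ℓ) (w a : E d) :
    HasCompactSupport (bumpAt φ ℓ w a) :=
  HasCompactSupport.of_support_subset_isCompact (isCompact_closedBall (a + ℓ • w) (ℓ * δ))
    fun _ hy => Metric.ball_subset_closedBall (mem_ball_of_bumpAt_ne_zero hφδ hℓ hy)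

theorem memLp_bumpAt (hφ : ContDiff ℝ ∞ φ) (hφδ : ∀ y, φ y ≠ 0 → ‖y‖ < δ) (hℓ : 0 < ℓ)
    (w a : E d) : MemLp (bumpAt φ ℓ w a) 2 (volume : Measure (E d)) :=
  (contDiff_bumpAt hφ ℓ w a).continuous.memLp_of_hasCompactSupport
    (hasCompactSupport_bumpAt hφδ hℓ w a)

theorem norm_toLp_bumpAt_sq (hφ : ContDiff ℝ ∞ φ) (hφδ : ∀ y, φ y ≠ 0 → ‖y‖ < δ) (hℓ : 0 < ℓ)
    (w a : E d) : ‖(memLp_bumpAt hφ hφδ hℓ w a).toLp _‖ ^ 2 = ℓ ^ d * ∫ y, φ y ^ 2 := by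
  set F := (memLp_bumpAt hφ hφδ hℓ w a).toLp _
  have h1 : ⟪F, F⟫_ℂ = ((∫ y, φ (ℓ⁻¹ • (y - a) - w) ^ 2 : ℝ) : ℂ) := by
    rw [L2.inner_def, ← integral_complex_ofReal]
    refine integral_congr_ae ?_
    filter_upwards [(memLp_bumpAt hφ hφδ hℓ w a).coeFn_toLp] with y hy
    rw [hy, RCLike.inner_apply]
    simp [bumpAt, sq]
  have h2 : ∫ y, φ (ℓ⁻¹ • (y - a) - w) ^ 2 = ℓ ^ d * ∫ y, φ y ^ 2 := by
    rw [integral_sub_right_eq_self (fun y => φ (ℓ⁻¹ • y - w) ^ 2) a,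
      Measure.integral_comp_inv_smul volume (fun y => φ (y - w) ^ 2) ℓ,
      integral_sub_right_eq_self (fun y => φ y ^ 2) w, finrank_euclideanSpace_fin,
      abs_of_nonneg (by positivity), smul_eq_mul]
  rw [inner_self_eq_norm_sq_to_K, h2] at h1
  simp only [Complex.coe_algebraMap] at h1
  exact_mod_cast h1

theorem inner_toLp_bumpAt_eq_zero (hφ : ContDiff ℝ ∞ φ) (hφδ : ∀ y, φ y ≠ 0 → ‖y‖ < δ)
    (hℓ : 0 < ℓ) (w : E d) {a b : E d} (hab : ℓ * (2 * δ) ≤ ‖a - b‖) :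
    ⟪(memLp_bumpAt hφ hφδ hℓ w a).toLp _, (memLp_bumpAt hφ hφδ hℓ w b).toLp _⟫_ℂ = 0 := by
  rw [L2.inner_def]
  refine integral_eq_zero_of_ae ?_
  filter_upwards [(memLp_bumpAt hφ hφδ hℓ w a).coeFn_toLp,
    (memLp_bumpAt hφ hφδ hℓ w b).coeFn_toLp] with y h1 h2
  rw [h1, h2, RCLike.inner_apply]
  by_contra hne
  have ha := mem_ball_of_bumpAt_ne_zero hφδ hℓ (w := w) (a := a) (y := y)
    fun h => hne (by simp [h])
  have hb := mem_ball_of_bumpAt_ne_zero hφδ hℓ (w := w) (a := b) (y := y)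
    fun h => hne (by simp [h])
  rw [mem_ball_iff_norm] at ha hb
  have h3 : a - b = (y - (b + ℓ • w)) - (y - (a + ℓ • w)) := by abel
  have h4 := norm_sub_le (y - (b + ℓ • w)) (y - (a + ℓ • w))
  rw [← h3] at h4
  linarith

end bumpAt

/-- The matrix element of the commutator between bumps of size `ℓ` at `a` and `a + ℓ w`, in
rescaled variables. -/
noncomputable def bumpElement {d : ℕ} (k f : E d → ℂ) (φ : E d → ℝ) (w : E d) (ρ ℓ : ℝ) (a : E d) :
    ℂ :=
  ∫ p : E d × E d, cutKernel k ρ (p.1 - p.2 - w) * ((φ p.2 : ℂ) * (φ p.1 : ℂ)) *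
    (f (a + ℓ • (p.2 + w)) - f (a + ℓ • p.1))

/-- The substitution has Jacobian ℓ^(2d) and homogeneity of the kernel gives ℓ^(-d), which leaves
ℓ^d, the same power as in the squared norm of a bump. -/
theorem inner_commutator_bumpAt {d : ℕ} {k : E d → ℂ} (hk : IsCZKernel k)
    {K : L2 d →L[ℂ] L2 d} (hK : IsSingularIntegral k K) {f f' : E d → ℂ}
    (hf : LocallyIntegrable f) (hff' : f =ᵐ[volume] f') {φ : E d → ℝ} {δ ρ ℓ : ℝ}
    (hφ : ContDiff ℝ ∞ φ) (hφδ : ∀ y, φ y ≠ 0 → ‖y‖ < δ) (hρ : 0 < ρ) (hℓ : 0 < ℓ) {w : E d}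
    (hw : ρ + 2 * δ ≤ ‖w‖) (a : E d)
    (hdom : (memLp_bumpAt hφ hφδ hℓ w a).toLp _ ∈ commutatorDomain K f) :
    ⟪(memLp_bumpAt hφ hφδ hℓ 0 a).toLp _, commutator K f
      ⟨(memLp_bumpAt hφ hφδ hℓ w a).toLp _, hdom⟩⟫_ℂ =
        ((ℓ ^ d : ℝ) : ℂ) * bumpElement k f' φ w ρ ℓ a := by
  rw [inner_commutator_eq hk hK hf hff' (contDiff_bumpAt hφ ℓ w a)
    (hasCompactSupport_bumpAt hφδ hℓ w a) (memLp_bumpAt hφ hφδ hℓ w a) hdom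
    (contDiff_bumpAt hφ ℓ 0 a).continuous (hasCompactSupport_bumpAt hφδ hℓ 0 a)
    (memLp_bumpAt hφ hφδ hℓ 0 a) (mul_pos hℓ hρ) (U := Metric.ball (a + ℓ • w) (ℓ * δ))
    Metric.isOpen_ball (fun y hy => mem_ball_of_bumpAt_ne_zero hφδ hℓ hy)]
  · set Θ : E d × E d → ℂ := fun p => cutKernel k (ℓ * ρ) (p.1 - p.2) * (f' p.2 - f' p.1) *
      (bumpAt φ ℓ w a p.2 * conj (bumpAt φ ℓ 0 a p.1)) with hΘ
    have hHaar : (volume : Measure (E d × E d)).IsAddHaarMeasure :=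
      inferInstanceAs ((volume : Measure (E d)).prod volume).IsAddHaarMeasure
    have h1 : ∫ p, Θ p = ∫ p, Θ (p + (a, a + ℓ • w)) := (integral_add_right_eq_self Θ _).symm
    have h2 := Measure.integral_comp_smul (volume : Measure (E d × E d))
      (fun p => Θ (p + (a, a + ℓ • w))) ℓ
    have hfr : Module.finrank ℝ (E d × E d) = d + d := by
      rw [Module.finrank_prod, finrank_euclideanSpace_fin]
    have hpos : 0 < ℓ ^ (d + d) := by positivity
    rw [hfr, abs_of_nonneg (by positivity), ← h1] at h2
    have h3 : ∀ p : E d × E d, Θ (ℓ • p + (a, a + ℓ • w)) = (((ℓ ^ d)⁻¹ : ℝ) : ℂ) *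
        (cutKernel k ρ (p.1 - p.2 - w) * ((φ p.2 : ℂ) * (φ p.1 : ℂ)) *
          (f' (a + ℓ • (p.2 + w)) - f' (a + ℓ • p.1))) := by
      rintro ⟨u, v⟩
      have e1 : ℓ • u + a - (ℓ • v + (a + ℓ • w)) = ℓ • (u - v - w) := by
        simp only [smul_sub]; abel
      have e2 : ℓ • v + (a + ℓ • w) = a + ℓ • (v + w) := by rw [smul_add]; abel
      have e3 : ℓ • u + a = a + ℓ • u := add_comm _ _
      have e4 : bumpAt φ ℓ w a (a + ℓ • (v + w)) = φ v := by
        simp [bumpAt, smul_smul, hℓ.ne']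
      have e5 : bumpAt φ ℓ 0 a (a + ℓ • u) = φ u := by
        simp [bumpAt, smul_smul, hℓ.ne']
      simp only [hΘ, Prod.smul_mk, Prod.mk_add_mk, e1]
      rw [hk.cutKernel_smul hρ hℓ, e2, e3, e4, e5, Complex.conj_ofReal, Complex.real_smul]
      ring
    simp only [h3] at h2
    rw [integral_const_mul] at h2
    change _ * bumpElement k f' φ w ρ ℓ a = _ at h2
    rw [Complex.real_smul] at h2
    have h4 : ∫ p, Θ p = ((ℓ ^ (d + d) : ℝ) : ℂ) *
        (((((ℓ ^ d)⁻¹ : ℝ) : ℂ)) * bumpElement k f' φ w ρ ℓ a) := by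
      rw [h2, ← mul_assoc, ← Complex.ofReal_mul, mul_inv_cancel₀ hpos.ne', Complex.ofReal_one,
        one_mul]
    rw [h4, ← mul_assoc, ← Complex.ofReal_mul, pow_add, mul_assoc,
      mul_inv_cancel₀ (by positivity), mul_one]
  · intro x hx y hy
    have hx' := mem_ball_of_bumpAt_ne_zero hφδ hℓ hx
    rw [smul_zero, add_zero, mem_ball_iff_norm] at hx'
    rw [mem_ball_iff_norm] at hy
    have h1 : ℓ • w = (x - a) - (x - y) - (y - (a + ℓ • w)) := by abel
    have h2 : ‖ℓ • w‖ ≤ ‖x - a‖ + ‖x - y‖ + ‖y - (a + ℓ • w)‖ := by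
      conv_lhs => rw [h1]
      exact (norm_sub_le _ _).trans (add_le_add (norm_sub_le _ _) le_rfl)
    rw [norm_smul, Real.norm_of_nonneg hℓ.le] at h2
    have h3 : ℓ * (ρ + 2 * δ) ≤ ℓ * ‖w‖ := by gcongr
    linarith

/-! ### Averaging over lattices -/

/-- The point of `ℝ^d` with the given integer coordinates. -/
noncomputable def latticePoint {d : ℕ} (j : Fin d → ℤ) : E d := WithLp.toLp 2 fun i => (j i : ℝ)

theorem one_le_norm_latticePoint_sub {d : ℕ} {i j : Fin d → ℤ} (hij : i ≠ j) :
    1 ≤ ‖latticePoint i - latticePoint j‖ := by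
  obtain ⟨n, hn⟩ := Function.ne_iff.1 hij
  refine le_trans ?_ (PiLp.norm_apply_le (latticePoint i - latticePoint j) n)
  have h1 : (latticePoint i - latticePoint j) n = ((i n - j n : ℤ) : ℝ) := by
    simp [latticePoint]
  rw [h1, Real.norm_eq_abs]
  exact_mod_cast Int.one_le_abs (sub_ne_zero.2 hn)

/-- The index set of a box of lattice points. -/
noncomputable def latticeBox (d M : ℕ) : Finset (Fin d → ℤ) :=
  Fintype.piFinset fun _ => Finset.Icc (-(M : ℤ)) M

theorem card_latticeBox (d M : ℕ) : (latticeBox d M).card = (2 * M + 1) ^ d := by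
  rw [latticeBox, Fintype.card_piFinset_const, Int.card_Icc]
  simp
  congr 1
  omega

/-- As δ ≤ 1/2, bumps centred at points of a lattice of spacing ℓ have disjoint supports, so the
trace inequality applies with the weights η absorbed in one family. The ℓ^d from the norms cancels
the ℓ^d from rescaling. -/
theorem enorm_sum_bumpElement_le {d : ℕ} (hd : 1 ≤ d) {k : E d → ℂ} (hk : IsCZKernel k)
    {K : L2 d →L[ℂ] L2 d} (hK : IsSingularIntegral k K) {f f' : E d → ℂ}
    (hf : MemBMO f) (hff' : f =ᵐ[volume] f') {φ : E d → ℝ} {δ ρ ℓ : ℝ}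
    (hφ : ContDiff ℝ ∞ φ) (hφδ : ∀ y, φ y ≠ 0 → ‖y‖ < δ) (hδ : δ ≤ 1 / 2) (hρ : 0 < ρ)
    (hℓ : 0 < ℓ) {w : E d} (hw : ρ + 2 * δ ≤ ‖w‖) {η : E d → ℝ} {B : ℝ} (hB : 0 < B)
    (hη : ∀ x, |η x| ≤ B) (M : ℕ) (a : E d) :
    ‖∑ j ∈ latticeBox d M, (η (a + ℓ • latticePoint j) : ℂ) *
      bumpElement k f' φ w ρ ℓ (a + ℓ • latticePoint j)‖ₑ ≤
        ENNReal.ofReal (B * ((∫ y, φ y ^ 2) + 1)) *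
          ∑ n ∈ Finset.range ((2 * M + 1) ^ d), singularValue (commutator K f) n := by
  -- Adding 1 makes the constant positive without assuming φ ≠ 0.
  set S := (∫ y, φ y ^ 2) + 1 with hS
  have hS0 : 0 < S := by
    have : 0 ≤ ∫ y, φ y ^ 2 := integral_nonneg fun _ => sq_nonneg _
    positivity
  set q := Real.sqrt (ℓ ^ d * S) with hq
  have hq0 : 0 < q := by positivity
  have hqq : q * q = ℓ ^ d * S := Real.mul_self_sqrt (by positivity)
  have hnorm : ∀ w b : E d, ‖(memLp_bumpAt hφ hφδ hℓ w b).toLp _‖ ≤ q := by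
    intro w b
    refine Real.le_sqrt_of_sq_le ?_
    rw [norm_toLp_bumpAt_sq hφ hφδ hℓ]
    gcongr
    linarith
  set pt : latticeBox d M → E d := fun j => a + ℓ • latticePoint (j : Fin d → ℤ) with hpt
  have hsep : ∀ i j, i ≠ j → ℓ * (2 * δ) ≤ ‖pt i - pt j‖ := by
    intro i j hij
    have h1 : pt i - pt j = ℓ • (latticePoint (i : Fin d → ℤ) - latticePoint (j : Fin d → ℤ)) := by
      simp [hpt, smul_sub]
    rw [h1, norm_smul, Real.norm_of_nonneg hℓ.le]
    have h2 := one_le_norm_latticePoint_sub fun h => hij (Subtype.ext h)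
    gcongr
    linarith
  have hdom : ∀ b, (memLp_bumpAt hφ hφδ hℓ w b).toLp _ ∈ commutatorDomain K f := fun b =>
    toLp_mem_commutatorDomain hd hk hK hf (contDiff_bumpAt hφ ℓ w b)
      (hasCompactSupport_bumpAt hφδ hℓ w b) _
  have hKF := enorm_sum_inner_le_sum_singularValue (commutator K f)
    (fun j : latticeBox d M => (η (pt j) : ℂ) •
      (⟨(memLp_bumpAt hφ hφδ hℓ w (pt j)).toLp _, hdom (pt j)⟩ : (commutator K f).domain))
    (fun j => (memLp_bumpAt hφ hφδ hℓ 0 (pt j)).toLp _) (C := B * q) (D := q)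
    (by positivity) hq0 (fun i j hij => by
      rw [Submodule.coe_smul, Submodule.coe_smul, inner_smul_left, inner_smul_right,
        inner_toLp_bumpAt_eq_zero hφ hφδ hℓ w (hsep i j hij), mul_zero, mul_zero])
    (fun i j hij => inner_toLp_bumpAt_eq_zero hφ hφδ hℓ 0 (hsep i j hij))
    (fun i => by
      rw [Submodule.coe_smul, norm_smul]
      have h1 : ‖((η (pt i) : ℝ) : ℂ)‖ ≤ B := by
        rw [Complex.norm_real]; exact hη _
      have h2 := hnorm w (pt i)
      gcongr)
    (fun i => hnorm 0 (pt i))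
  have hsum : ∑ j : latticeBox d M, ⟪(memLp_bumpAt hφ hφδ hℓ 0 (pt j)).toLp _,
      commutator K f ((η (pt j) : ℂ) •
      (⟨(memLp_bumpAt hφ hφδ hℓ w (pt j)).toLp _, hdom (pt j)⟩ : (commutator K f).domain))⟫_ℂ =
      ((ℓ ^ d : ℝ) : ℂ) * ∑ j ∈ latticeBox d M, (η (a + ℓ • latticePoint j) : ℂ) *
        bumpElement k f' φ w ρ ℓ (a + ℓ • latticePoint j) := by
    rw [← Finset.sum_coe_sort (latticeBox d M), Finset.mul_sum]
    refine Finset.sum_congr rfl fun j _ => ?_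
    rw [LinearPMap.map_smul, inner_smul_right,
      inner_commutator_bumpAt hk hK hf.1 hff' hφ hφδ hρ hℓ hw (pt j) (hdom (pt j))]
    ring
  rw [hsum, enorm_mul, Fintype.card_coe, card_latticeBox] at hKF
  have hl : ‖((ℓ ^ d : ℝ) : ℂ)‖ₑ = ENNReal.ofReal (ℓ ^ d) := by
    rw [← ofReal_norm, Complex.norm_real, Real.norm_of_nonneg (by positivity)]
  have hc : B * q * q = ℓ ^ d * (B * S) := by rw [mul_assoc, hqq]; ring
  rw [hl, hc, ENNReal.ofReal_mul (by positivity), mul_assoc] at hKF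
  exact (ENNReal.mul_le_mul_iff_right (ENNReal.ofReal_pos.2 (by positivity)).ne'
    ENNReal.ofReal_ne_top).1 hKF

/-- The half-open cube `[0, ℓ)^d`. -/
def cube (d : ℕ) (ℓ : ℝ) : Set (E d) := {x | ∀ i, 0 ≤ x i ∧ x i < ℓ}

theorem measurableSet_cube (d : ℕ) (ℓ : ℝ) : MeasurableSet (cube d ℓ) := by
  have : cube d ℓ = ⋂ i, {x : E d | 0 ≤ x i ∧ x i < ℓ} := by
    ext x
    simp [cube]
  rw [this]
  have hm : ∀ i, Measurable fun x : E d => x i := fun i => by fun_prop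
  exact MeasurableSet.iInter fun i =>
    (measurableSet_le measurable_const (hm i)).inter (measurableSet_lt (hm i) measurable_const)

theorem volume_cube (d : ℕ) {ℓ : ℝ} (hℓ : 0 ≤ ℓ) : volume (cube d ℓ) = ENNReal.ofReal (ℓ ^ d) := by
  have h1 : cube d ℓ = WithLp.ofLp ⁻¹' (Set.pi Set.univ fun _ : Fin d => Set.Ico (0 : ℝ) ℓ) := by
    ext x
    simp [cube]
  rw [h1, (PiLp.volume_preserving_ofLp (Fin d)).measure_preimage
    (MeasurableSet.univ_pi fun _ => measurableSet_Ico).nullMeasurableSet, Real.volume_pi_Ico]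
  simp [ENNReal.ofReal_pow hℓ]

/-- The translates of the half-open cube by the lattice tile space, and those indexed by the box
cover the support. It passes from an integral over a to lattice sums with a variable shift. -/
theorem integral_eq_setIntegral_cube_sum {d : ℕ} {ℓ : ℝ} (hℓ : 0 < ℓ) (M : ℕ) {G : E d → ℂ}
    (hG : Integrable G) (hsupp : ∀ x, G x ≠ 0 → ∀ i, |x i| ≤ ℓ * M) :
    ∫ x, G x = ∫ a in cube d ℓ, ∑ j ∈ latticeBox d M, G (a + ℓ • latticePoint j) := by
  classical
  set Q : (Fin d → ℤ) → Set (E d) := fun j => (fun x => x - ℓ • latticePoint j) ⁻¹' cube d ℓ with hQ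
  have hQm : ∀ j, MeasurableSet (Q j) := fun j =>
    (measurableSet_cube d ℓ).preimage (measurable_id.sub_const _)
  -- The cell containing x is found by taking integer parts; this gives both disjointness and
  -- covering.
  have hQmem : ∀ j (x : E d), x ∈ Q j ↔ ∀ i, j i = ⌊x i / ℓ⌋ := by
    intro j x
    simp only [hQ, Set.mem_preimage, cube, Set.mem_ofPred_eq]
    refine forall_congr' fun i => ?_
    have h1 : (x - ℓ • latticePoint j) i = x i - ℓ * j i := by simp [latticePoint]
    rw [h1, eq_comm, Int.floor_eq_iff, le_div_iff₀ hℓ, div_lt_iff₀ hℓ]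
    constructor
    · rintro ⟨h2, h3⟩
      constructor <;> linarith
    · rintro ⟨h2, h3⟩
      constructor <;> linarith
  have hdisj : Set.Pairwise (↑(latticeBox d M)) (Function.onFun Disjoint Q) := by
    intro i _ j _ hij
    refine Set.disjoint_left.2 fun x hi hj => hij ?_
    funext n
    rw [(hQmem i x).1 hi n, (hQmem j x).1 hj n]
  have h1 : ∫ x, G x = ∫ x in ⋃ j ∈ latticeBox d M, Q j, G x := by
    refine (setIntegral_eq_integral_of_forall_compl_eq_zero fun x hx => ?_).symm
    by_contra hne
    refine hx (Set.mem_iUnion₂.2 ⟨fun i => ⌊x i / ℓ⌋, ?_, (hQmem _ x).2 fun i => rfl⟩)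
    rw [latticeBox, Fintype.mem_piFinset]
    intro i
    have h2 := abs_le.1 (hsupp x hne i)
    rw [Finset.mem_Icc]
    constructor
    · rw [Int.le_floor, le_div_iff₀ hℓ]
      push_cast
      linarith
    · have h3 : (⌊x i / ℓ⌋ : ℝ) ≤ M := (Int.floor_le _).trans (by
        rw [div_le_iff₀ hℓ]; linarith)
      exact_mod_cast h3
  rw [h1, integral_biUnion_finset _ (fun j _ => hQm j) hdisj fun j _ => hG.integrableOn,
    integral_finsetSum _ fun j _ => (hG.comp_add_right _).integrableOn]
  refine Finset.sum_congr rfl fun j _ => ?_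
  rw [← integral_indicator (hQm j), ← integral_indicator (measurableSet_cube d ℓ),
    ← integral_add_right_eq_self _ (ℓ • latticePoint j)]
  refine integral_congr_ae (ae_of_all _ fun x => ?_)
  simp [Set.indicator_apply, hQ]

/-! ### Pairing with translates -/

/-- The pairing of the translates of `f` with the test function `η`. -/
noncomputable def pairing {d : ℕ} (f : E d → ℂ) (η : E d → ℝ) (z : E d) : ℂ :=
  ∫ a, (η a : ℂ) * f (a + z)

theorem pairing_eq_convolution {d : ℕ} (f : E d → ℂ) (η : E d → ℝ) :
    pairing f η = convolution (fun x => η (-x)) f (ContinuousLinearMap.lsmul ℝ ℝ) volume := by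
  funext z
  rw [convolution_def, pairing, ← integral_neg_eq_self]
  refine integral_congr_ae (ae_of_all _ fun x => ?_)
  simp only [ContinuousLinearMap.lsmul_apply, Complex.real_smul]
  rw [neg_add_eq_sub]

/-- The derivatives fall on η, so local integrability of f is enough. -/
theorem contDiff_pairing {d : ℕ} {f : E d → ℂ} (hf : LocallyIntegrable f) {η : E d → ℝ}
    (hη : ContDiff ℝ ∞ η) (hηc : HasCompactSupport η) : ContDiff ℝ ∞ (pairing f η) := by
  rw [pairing_eq_convolution]
  exact (hηc.comp_homeomorph (Homeomorph.neg (E d))).contDiff_convolution_left _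
    (hη.comp contDiff_neg) hf

/-- Justifies Fubini below: the shifts τ are bounded where κ ≠ 0, so all the translates of f that
occur are integrated over one fixed ball. -/
theorem integrable_mul_translate {d : ℕ} {f : E d → ℂ} (hf : LocallyIntegrable f)
    (hfm : Measurable f) {η : E d → ℝ} (hη : Continuous η) (hηc : HasCompactSupport η)
    {X : Type*} [MeasurableSpace X] {ν : Measure X} [SFinite ν] {κ : X → ℂ} (hκ : Integrable κ ν)
    {τ : X → E d} (hτ : Measurable τ) {S : ℝ} (hS : ∀ p, κ p ≠ 0 → ‖τ p‖ ≤ S) :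
    Integrable (fun q : E d × X => (η q.1 : ℂ) * (κ q.2 * f (q.1 + τ q.2)))
      ((volume : Measure (E d)).prod ν) := by
  classical
  obtain ⟨B, hB⟩ := hηc.exists_bound_of_continuous hη
  obtain ⟨R, hR⟩ : ∃ R : ℝ, ∀ x, η x ≠ 0 → ‖x‖ ≤ R := by
    obtain ⟨R, hR⟩ := hηc.isBounded.exists_norm_le
    exact ⟨R, fun x hx => hR x (subset_tsupport η hx)⟩
  have hmeas : AEStronglyMeasurable (fun q : E d × X => (η q.1 : ℂ) * (κ q.2 * f (q.1 + τ q.2)))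
      ((volume : Measure (E d)).prod ν) := by
    refine AEStronglyMeasurable.mul ?_ (AEStronglyMeasurable.mul ?_ ?_)
    · exact (Complex.measurable_ofReal.comp
        (hη.measurable.comp measurable_fst)).aestronglyMeasurable
    · exact hκ.aestronglyMeasurable.comp_snd
    · exact (hfm.comp (measurable_fst.add (hτ.comp measurable_snd))).aestronglyMeasurable
  have hslice : ∀ z : E d, Integrable fun a => (η a : ℂ) * f (a + z) := by
    intro z
    have hfz : LocallyIntegrable fun a => f (a + z) := by
      intro x
      refine ⟨Metric.closedBall x 1, Metric.closedBall_mem_nhds x one_pos, ?_⟩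
      have h1 := hf.integrableOn_isCompact (isCompact_closedBall (x + z) 1)
      rw [← integrable_indicator_iff Metric.isClosed_closedBall.measurableSet] at h1 ⊢
      refine (h1.comp_add_right z).congr (ae_of_all _ fun a => ?_)
      simp [Set.indicator_apply, Metric.mem_closedBall]
    refine (hfz.integrable_smul_left_of_hasCompactSupport hη hηc).congr (ae_of_all _ fun a => ?_)
    simp
  refine (integrable_prod_iff' hmeas).2 ⟨ae_of_all _ fun p => ?_, ?_⟩
  · refine ((hslice (τ p)).const_mul (κ p)).congr (ae_of_all _ fun a => ?_)
    simp only
    ring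
  · have hball : IntegrableOn f (Metric.closedBall 0 (R + S)) :=
      hf.integrableOn_isCompact (isCompact_closedBall _ _)
    refine (hκ.norm.mul_const (|B| * ∫ x in Metric.closedBall 0 (R + S), ‖f x‖)).mono'
      hmeas.norm.prod_swap.integral_prod_right' (ae_of_all _ fun p => ?_)
    rw [Real.norm_of_nonneg (integral_nonneg fun _ => norm_nonneg _)]
    have e1 : ∫ a, ‖(η a : ℂ) * (κ p * f (a + τ p))‖ = ‖κ p‖ * ∫ a, ‖(η a : ℂ) * f (a + τ p)‖ := by
      rw [← integral_const_mul]
      refine integral_congr_ae (ae_of_all _ fun a => ?_)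
      simp only [norm_mul]
      ring
    rw [e1]
    by_cases hp : κ p = 0
    · simp [hp]
    gcongr
    have e2 := integral_add_right_eq_self (μ := (volume : Measure (E d)))
      ((Metric.closedBall 0 (R + S)).indicator fun x => |B| * ‖f x‖) (τ p)
    rw [← integral_const_mul, ← integral_indicator Metric.isClosed_closedBall.measurableSet, ← e2]
    refine integral_mono (hslice (τ p)).norm ?_ fun a => ?_
    · exact (((integrable_indicator_iff Metric.isClosed_closedBall.measurableSet).2
        (hball.norm.const_mul |B|)).comp_add_right (τ p))
    · simp only
      by_cases ha : η a = 0
      · simp only [ha, Complex.ofReal_zero, zero_mul, norm_zero]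
        exact Set.indicator_nonneg (fun _ _ => by positivity) _
      · rw [Set.indicator_of_mem]
        · rw [norm_mul, Complex.norm_real]
          gcongr
          exact (hB a).trans (le_abs_self B)
        · rw [mem_closedBall_zero_iff]
          exact (norm_add_le _ _).trans (add_le_add (hR a ha) (hS p hp))

/-- Interchanging the integrals makes f enter only through its smooth pairing with η, so that a
first-order expansion becomes available. -/
theorem integral_mul_bumpElement {d : ℕ} {k : E d → ℂ} (hk : IsCZKernel k) {f : E d → ℂ}
    (hf : LocallyIntegrable f) (hfm : Measurable f) {φ : E d → ℝ} {δ ρ : ℝ}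
    (hφi : Integrable φ) (hφδ : ∀ y, φ y ≠ 0 → ‖y‖ < δ) (hρ : 0 < ρ)
    (ℓ : ℝ) (w : E d) {η : E d → ℝ} (hη : Continuous η) (hηc : HasCompactSupport η) :
    Integrable (fun a => (η a : ℂ) * bumpElement k f φ w ρ ℓ a) ∧
    ∫ a, (η a : ℂ) * bumpElement k f φ w ρ ℓ a =
      ∫ p : E d × E d, cutKernel k ρ (p.1 - p.2 - w) * ((φ p.2 : ℂ) * (φ p.1 : ℂ)) *
        (pairing f η (ℓ • (p.2 + w)) - pairing f η (ℓ • p.1)) := by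
  set κ : E d × E d → ℂ :=
    fun p => cutKernel k ρ (p.1 - p.2 - w) * ((φ p.2 : ℂ) * (φ p.1 : ℂ)) with hκdef
  obtain ⟨C, -, hC⟩ := hk.exists_norm_cutKernel_le hρ
  have hκ : Integrable κ (volume : Measure (E d × E d)) := by
    change Integrable κ (volume.prod volume)
    refine Integrable.bdd_mul (c := C) ?_ ?_ (ae_of_all _ fun p => hC _)
    · refine ((hφi.ofReal (𝕜 := ℂ)).mul_prod (hφi.ofReal (𝕜 := ℂ))).congr
        (ae_of_all _ fun p => ?_)
      simp [mul_comm]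
    · exact ((hk.measurable_cutKernel ρ).comp
        ((measurable_fst.sub measurable_snd).sub_const w)).aestronglyMeasurable
  have hsupp : ∀ p, κ p ≠ 0 → ‖p.1‖ < δ ∧ ‖p.2‖ < δ := fun p hp =>
    ⟨hφδ _ fun h => hp (by simp [hκdef, h]), hφδ _ fun h => hp (by simp [hκdef, h])⟩
  have i1 := integrable_mul_translate hf hfm hη hηc hκ (τ := fun p => ℓ • (p.2 + w))
    ((measurable_snd.add_const w).const_smul ℓ) (S := |ℓ| * (δ + ‖w‖)) (fun p hp => by
      rw [norm_smul, Real.norm_eq_abs]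
      gcongr
      exact (norm_add_le _ _).trans (add_le_add (hsupp p hp).2.le le_rfl))
  have i2 := integrable_mul_translate hf hfm hη hηc hκ (τ := fun p => ℓ • p.1)
    (measurable_fst.const_smul ℓ) (S := |ℓ| * δ) (fun p hp => by
      rw [norm_smul, Real.norm_eq_abs]
      have := (hsupp p hp).1.le
      gcongr)
  have i3 := i1.sub i2
  have e1 : ∀ a, (η a : ℂ) * bumpElement k f φ w ρ ℓ a = ∫ p : E d × E d,
      ((fun q : E d × (E d × E d) => (η q.1 : ℂ) * (κ q.2 * f (q.1 + ℓ • (q.2.2 + w)))) -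
        fun q : E d × (E d × E d) => (η q.1 : ℂ) * (κ q.2 * f (q.1 + ℓ • q.2.1))) (a, p) := by
    intro a
    rw [bumpElement, ← integral_const_mul]
    refine integral_congr_ae (ae_of_all _ fun p => ?_)
    simp only [Pi.sub_apply, hκdef]
    ring
  refine ⟨i3.integral_prod_left.congr (ae_of_all _ fun a => (e1 a).symm), ?_⟩
  simp only [e1]
  rw [integral_integral_swap (f := fun a p => ((fun q : E d × (E d × E d) =>
    (η q.1 : ℂ) * (κ q.2 * f (q.1 + ℓ • (q.2.2 + w)))) -
        fun q : E d × (E d × E d) => (η q.1 : ℂ) * (κ q.2 * f (q.1 + ℓ • q.2.1))) (a, p)) i3]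
  refine integral_congr_ae ?_
  filter_upwards [i1.prod_left_ae, i2.prod_left_ae] with p h1 h2
  simp only [Pi.sub_apply]
  rw [integral_sub h1 h2, mul_sub, pairing, pairing, ← integral_const_mul, ← integral_const_mul]
  congr 1 <;>
  · refine integral_congr_ae (ae_of_all _ fun a => ?_)
    simp only [hκdef]
    ring

/-- Strict differentiability of Φ at 0 handles both moving points at once: their difference is
ℓ(w+v-u), close to ℓw, and the kernel is continuous at -w. -/
theorem exists_norm_kernel_mul_sub_le {d : ℕ} {k : E d → ℂ} (hk : ContinuousOn k {0}ᶜ)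
    {Φ : E d → ℂ} (hΦ : ContDiff ℝ ∞ Φ) {w : E d} (hw : w ≠ 0) {ε : ℝ} (hε : 0 < ε) :
    ∃ δ > 0, ∃ ℓ₀ > 0, ∀ (u v : E d) (ℓ : ℝ), ‖u‖ < δ → ‖v‖ < δ → 0 < ℓ → ℓ < ℓ₀ →
      ‖k (u - v - w) * (Φ (ℓ • (v + w)) - Φ (ℓ • u)) - ℓ * (k (-w) * fderiv ℝ Φ 0 w)‖ ≤ ε * ℓ := by
  set F : Filter ((E d × E d) × ℝ) := 𝓝 (0, 0) ×ˢ 𝓝[>] 0 with hF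
  have hp : Tendsto (fun q : (E d × E d) × ℝ => q.1) F (𝓝 (0, 0)) := tendsto_fst
  have hu : Tendsto (fun q : (E d × E d) × ℝ => q.1.1) F (𝓝 0) :=
    (continuous_fst.tendsto ((0 : E d), (0 : E d))).comp hp
  have hv : Tendsto (fun q : (E d × E d) × ℝ => q.1.2) F (𝓝 0) :=
    (continuous_snd.tendsto ((0 : E d), (0 : E d))).comp hp
  have hl' : Tendsto (fun q : (E d × E d) × ℝ => q.2) F (𝓝[>] 0) := tendsto_snd
  have hl : Tendsto (fun q : (E d × E d) × ℝ => q.2) F (𝓝 0) := hl'.mono_right nhdsWithin_le_nhds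
  have hx : Tendsto (fun q : (E d × E d) × ℝ => q.2 • (q.1.2 + w)) F (𝓝 0) := by
    simpa using hl.smul (hv.add_const w)
  have hy : Tendsto (fun q : (E d × E d) × ℝ => q.2 • q.1.1) F (𝓝 0) := by
    simpa using hl.smul hu
  have hstrict := hasStrictFDerivAt_iff_isLittleO.1
    (hΦ.contDiffAt.hasStrictFDerivAt (x := 0) (by simp))
  have h1 := hstrict.comp_tendsto (hx.prodMk_nhds hy)
  have hbd : Tendsto (fun q : (E d × E d) × ℝ => q.1.2 + w - q.1.1) F (𝓝 w) := by
    simpa using (hv.add_const w).sub hu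
  have h2 : (fun q : (E d × E d) × ℝ => q.2 • (q.1.2 + w) - q.2 • q.1.1) =O[F]
      fun q => q.2 := by
    have := (Asymptotics.isBigO_refl (fun q : (E d × E d) × ℝ => q.2) F).smul
      (hbd.isBigO_one ℝ)
    refine (this.congr_left fun q => ?_).congr_right fun q => ?_
    · rw [smul_sub]
    · simp
  have h3 := (h1.trans_isBigO h2).tendsto_inv_smul_nhds_zero
  have h4 : Tendsto (fun q : (E d × E d) × ℝ => fderiv ℝ Φ 0 (q.1.2 + w - q.1.1)) F
      (𝓝 (fderiv ℝ Φ 0 w)) := ((fderiv ℝ Φ 0).continuous.tendsto w).comp hbd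
  have hkt : Tendsto (fun q : (E d × E d) × ℝ => k (q.1.1 - q.1.2 - w)) F (𝓝 (k (-w))) := by
    have hc : ContinuousAt k (-w) :=
      hk.continuousAt (isOpen_compl_singleton.mem_nhds (by simpa using hw))
    refine hc.tendsto.comp ?_
    simpa using (hu.sub hv).sub_const w
  have h5 := hkt.mul (h3.add h4)
  rw [zero_add] at h5
  have h6 := (h5.eventually (Metric.closedBall_mem_nhds _ hε)).and
    (hl'.eventually self_mem_nhdsWithin)
  obtain ⟨pa, hpa, pb, hpb, hpab⟩ := eventually_prod_iff.1 h6
  obtain ⟨δ, hδ, hδp⟩ := Metric.eventually_nhds_iff.1 hpa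
  obtain ⟨ℓ₀, hℓ₀, hℓp⟩ := mem_nhdsGT_iff_exists_Ioo_subset.1 hpb
  refine ⟨δ, hδ, ℓ₀, hℓ₀, fun u v ℓ hu hv hℓ hℓ' => ?_⟩
  have h7 := (hpab (hδp (y := (u, v)) (by simp [Prod.dist_eq, hu, hv])) (hℓp ⟨hℓ, hℓ'⟩)).1
  simp only [Function.comp, dist_eq_norm] at h7
  have h8 : k (u - v - w) * (Φ (ℓ • (v + w)) - Φ (ℓ • u)) - ℓ * (k (-w) * fderiv ℝ Φ 0 w) =
      ℓ * (k (u - v - w) * (ℓ⁻¹ • (Φ (ℓ • (v + w)) - Φ (ℓ • u) -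
        fderiv ℝ Φ 0 (ℓ • (v + w) - ℓ • u)) + fderiv ℝ Φ 0 (v + w - u)) -
          k (-w) * fderiv ℝ Φ 0 w) := by
    have hℓc : (ℓ : ℂ) ≠ 0 := by exact_mod_cast hℓ.ne'
    rw [← smul_sub, map_smul, Complex.real_smul, Complex.real_smul, Complex.ofReal_inv]
    field_simp
    ring
  rw [h8, norm_mul, Complex.norm_real, Real.norm_of_nonneg hℓ.le, mul_comm ε]
  gcongr

/-! ### The lower bound on the singular values -/

/-- Averages against a product of normalized weights are close to `c` if the integrand is. -/
theorem norm_integral_mul_weight_sub_le {d : ℕ} {φ : E d → ℝ} (hφi : Integrable φ)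
    (hφ0 : ∀ y, 0 ≤ φ y) (hφ1 : ∫ y, φ y = 1) {F : E d × E d → ℂ}
    (hF : AEStronglyMeasurable F (volume : Measure (E d × E d))) {c : ℂ} {ε : ℝ}
    (h : ∀ p : E d × E d, φ p.1 ≠ 0 → φ p.2 ≠ 0 → ‖F p - c‖ ≤ ε) :
    ‖(∫ p : E d × E d, F p * ((φ p.1 * φ p.2 : ℝ) : ℂ)) - c‖ ≤ ε := by
  have hw : Integrable (fun p : E d × E d => φ p.1 * φ p.2) (volume : Measure (E d × E d)) :=
    hφi.mul_prod hφi
  have hw1 : ∫ p : E d × E d, φ p.1 * φ p.2 = 1 := by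
    have := integral_prod_mul (μ := (volume : Measure (E d))) (ν := (volume : Measure (E d))) φ φ
    rw [hφ1, mul_one] at this
    exact this
  have hwc : Integrable (fun p : E d × E d => ((φ p.1 * φ p.2 : ℝ) : ℂ) * c)
      (volume : Measure (E d × E d)) := (hw.ofReal (𝕜 := ℂ)).mul_const c
  have hpt : ∀ p : E d × E d, ‖F p * ((φ p.1 * φ p.2 : ℝ) : ℂ) - ((φ p.1 * φ p.2 : ℝ) : ℂ) * c‖ ≤
      ε * (φ p.1 * φ p.2) := by
    intro p
    by_cases h1 : φ p.1 = 0
    · simp [h1]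
    by_cases h2 : φ p.2 = 0
    · simp [h2]
    have h3 : 0 ≤ φ p.1 * φ p.2 := mul_nonneg (hφ0 _) (hφ0 _)
    rw [mul_comm (F p), ← mul_sub, norm_mul, Complex.norm_real, Real.norm_of_nonneg h3, mul_comm]
    exact mul_le_mul_of_nonneg_right (h p h1 h2) h3
  have hsub : Integrable (fun p : E d × E d => F p * ((φ p.1 * φ p.2 : ℝ) : ℂ) -
      ((φ p.1 * φ p.2 : ℝ) : ℂ) * c) (volume : Measure (E d × E d)) :=
    (hw.const_mul ε).mono' ((hF.mul (hw.ofReal (𝕜 := ℂ)).aestronglyMeasurable).sub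
      hwc.aestronglyMeasurable) (ae_of_all _ hpt)
  have h_int : Integrable (fun p : E d × E d => F p * ((φ p.1 * φ p.2 : ℝ) : ℂ))
      (volume : Measure (E d × E d)) := by
    refine (hsub.add hwc).congr (ae_of_all _ fun p => ?_)
    simp only [Pi.add_apply, sub_add_cancel]
  have hc : c = ∫ p : E d × E d, ((φ p.1 * φ p.2 : ℝ) : ℂ) * c := by
    rw [integral_mul_const, integral_complex_ofReal, hw1, Complex.ofReal_one, one_mul]
  calc _ = ‖∫ p : E d × E d, (F p * ((φ p.1 * φ p.2 : ℝ) : ℂ) -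
        ((φ p.1 * φ p.2 : ℝ) : ℂ) * c)‖ := by rw [integral_sub h_int hwc, ← hc]
    _ ≤ ∫ p : E d × E d, ε * (φ p.1 * φ p.2) :=
        norm_integral_le_of_norm_le (hw.const_mul ε) (ae_of_all _ hpt)
    _ = ε := by rw [integral_const_mul, hw1, mul_one]

/-- The weighted integral of the rescaled matrix elements is at least a multiple of ℓ, and at most a
multiple of ℓ^d times the sum of singular values. With ℓ = R/M this bounds the sum from below by a
multiple of M^(d-1). -/
theorem exists_ofReal_le_sum_singularValue {d : ℕ} (hd : 1 ≤ d) {k : E d → ℂ} (hk : IsCZKernel k)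
    {K : L2 d →L[ℂ] L2 d} (hK : IsSingularIntegral k K) {f f' : E d → ℂ} (hf : MemBMO f)
    (hff' : f =ᵐ[volume] f') (hf'm : Measurable f') {η : E d → ℝ} (hη : ContDiff ℝ ∞ η)
    (hηc : HasCompactSupport η) {w : E d} (hw : w ≠ 0)
    (hne : k (-w) * fderiv ℝ (pairing f' η) 0 w ≠ 0) :
    ∃ c : ℝ, 0 < c ∧ ∀ᶠ M : ℕ in atTop, ENNReal.ofReal (c * (M : ℝ) ^ (d - 1)) ≤
      ∑ n ∈ Finset.range ((2 * M + 1) ^ d), singularValue (commutator K f) n := by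
  have hf' : LocallyIntegrable f' := hf.1.congr hff'
  set c₀ := k (-w) * fderiv ℝ (pairing f' η) 0 w with hc₀
  -- Half of the leading coefficient: the main term 2εℓ then exceeds the error εℓ by εℓ.
  set ε := ‖c₀‖ / 2 with hε
  have hε0 : 0 < ε := by have := norm_pos_iff.2 hne; positivity
  obtain ⟨δ₀, hδ₀, ℓ₀, hℓ₀, hnear⟩ := exists_norm_kernel_mul_sub_le hk.smooth.continuousOn
    (contDiff_pairing hf' hη hηc) hw hε0
  have hw0 : 0 < ‖w‖ := norm_pos_iff.2 hw
  -- The three bounds serve the expansion, the disjointness of the lattice bumps, and the separation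
  -- of the two families by ρ = ‖w‖/2 in rescaled units.
  set δ := min δ₀ (min (1 / 2) (‖w‖ / 4)) with hδ
  have hδ0 : 0 < δ := by positivity
  have hδ1 : δ ≤ δ₀ := min_le_left _ _
  have hδ2 : δ ≤ 1 / 2 := (min_le_right _ _).trans (min_le_left _ _)
  have hδ3 : δ ≤ ‖w‖ / 4 := (min_le_right _ _).trans (min_le_right _ _)
  set ρ := ‖w‖ / 2 with hρ
  have hρ0 : 0 < ρ := by positivity
  have hwρ : ρ + 2 * δ ≤ ‖w‖ := by linarith
  let b : ContDiffBump (0 : E d) := ⟨δ / 2, δ, by positivity, by linarith⟩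
  set φ : E d → ℝ := b.normed volume with hφdef
  have hφ : ContDiff ℝ ∞ φ := b.contDiff_normed (n := ⊤)
  have hφi : Integrable φ := b.integrable_normed
  have hφ0 : ∀ y, 0 ≤ φ y := fun y => b.nonneg_normed y
  have hφ1 : ∫ y, φ y = 1 := b.integral_normed
  have hφδ : ∀ y, φ y ≠ 0 → ‖y‖ < δ := fun y hy => by
    have h1 : y ∈ Function.support (b.normed volume) := hy
    rw [b.support_normed_eq] at h1
    simpa using h1
  obtain ⟨B', hB'⟩ := hηc.exists_bound_of_continuous hη.continuous
  set B := |B'| + 1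
  have hB0 : 0 < B := by positivity
  have hB : ∀ x, |η x| ≤ B := fun x => (hB' x).trans ((le_abs_self B').trans (by simp [B]))
  obtain ⟨R, hR0, hR⟩ : ∃ R : ℝ, 0 < R ∧ ∀ x, η x ≠ 0 → ‖x‖ ≤ R := by
    obtain ⟨R, hR⟩ := hηc.isBounded.exists_norm_le
    exact ⟨|R| + 1, by positivity, fun x hx => (hR x (subset_tsupport η hx)).trans
      ((le_abs_self R).trans (by simp))⟩
  set S := (∫ y, φ y ^ 2) + 1 with hS
  have hS0 : 0 < S := by
    have : 0 ≤ ∫ y, φ y ^ 2 := integral_nonneg fun _ => sq_nonneg _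
    positivity
  refine ⟨ε / (B * S * R ^ (d - 1)), by positivity, ?_⟩
  have hlim : Tendsto (fun M : ℕ => R / (M : ℝ)) atTop (𝓝 0) := tendsto_const_div_atTop_nhds_zero_nat R
  filter_upwards [hlim.eventually (gt_mem_nhds hℓ₀), eventually_gt_atTop 0] with M hM hM0
  -- With ℓM = R the box of lattice cells covers the support of η.
  set ℓ := R / (M : ℝ) with hℓ
  have hMr : (0 : ℝ) < M := by exact_mod_cast hM0
  have hℓ0 : 0 < ℓ := by positivity
  obtain ⟨hi, he⟩ := integral_mul_bumpElement hk hf' hf'm hφi hφδ hρ0 ℓ w hη.continuous hηc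
  set I := ∫ a, (η a : ℂ) * bumpElement k f' φ w ρ ℓ a with hI
  -- the lower bound
  have hlow : ε * ℓ ≤ ‖I‖ := by
    set F : E d × E d → ℂ := fun p => cutKernel k ρ (p.1 - p.2 - w) *
      (pairing f' η (ℓ • (p.2 + w)) - pairing f' η (ℓ • p.1)) with hF
    have hFm : AEStronglyMeasurable F (volume : Measure (E d × E d)) := by
      have hP := (contDiff_pairing hf' hη hηc).continuous
      refine AEStronglyMeasurable.mul ?_ (Continuous.aestronglyMeasurable (by fun_prop))
      exact ((hk.measurable_cutKernel ρ).comp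
        ((measurable_fst.sub measurable_snd).sub_const w)).aestronglyMeasurable
    have hIF : I = ∫ p : E d × E d, F p * ((φ p.1 * φ p.2 : ℝ) : ℂ) := by
      rw [he]
      refine integral_congr_ae (ae_of_all _ fun p => ?_)
      simp only [hF, Complex.ofReal_mul]
      ring
    have hdiff : ‖I - ℓ * c₀‖ ≤ ε * ℓ := by
      rw [hIF]
      refine norm_integral_mul_weight_sub_le hφi hφ0 hφ1 hFm ?_
      rintro ⟨u, v⟩ hu hv
      have hu' := hφδ u hu
      have hv' := hφδ v hv
      have hcut : cutKernel k ρ (u - v - w) = k (u - v - w) := by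
        refine cutKernel_of_le k ?_
        have h1 : w = u - v - (u - v - w) := by abel
        have h2 : ‖w‖ ≤ ‖u‖ + ‖v‖ + ‖u - v - w‖ := by
          conv_lhs => rw [h1]
          exact (norm_sub_le _ _).trans (add_le_add (norm_sub_le _ _) le_rfl)
        linarith
      simp only [hF, hcut]
      exact hnear u v ℓ (hu'.trans_le hδ1) (hv'.trans_le hδ1) hℓ0 hM
    have h1 : ‖(ℓ : ℂ) * c₀‖ = 2 * ε * ℓ := by
      rw [norm_mul, Complex.norm_real, Real.norm_of_nonneg hℓ0.le, hε]
      ring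
    have h2 := norm_sub_norm_le ((ℓ : ℂ) * c₀) I
    rw [norm_sub_rev, h1] at h2
    linarith
  -- the upper bound
  set σ := ∑ n ∈ Finset.range ((2 * M + 1) ^ d), singularValue (commutator K f) n with hσ
  have hup : ‖I‖ₑ ≤ ENNReal.ofReal (B * S) * σ * ENNReal.ofReal (ℓ ^ d) := by
    rw [hI, integral_eq_setIntegral_cube_sum hℓ0 M hi, ← volume_cube d hℓ0.le]
    · refine (enorm_integral_le_lintegral_enorm _).trans ?_
      rw [← setLIntegral_const]
      exact lintegral_mono fun a =>
        enorm_sum_bumpElement_le hd hk hK hf hff' hφ hφδ hδ2 hρ0 hℓ0 hwρ hB0 hB M a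
    · intro x hx i
      have h1 : η x ≠ 0 := fun h => hx (by simp [h])
      have h2 : ℓ * M = R := by rw [hℓ]; field_simp
      rw [h2]
      exact (PiLp.norm_apply_le x i).trans (hR x h1)
  have hpos : 0 < ℓ ^ d * (B * S) := by positivity
  have hfin : ENNReal.ofReal (ℓ ^ d * (B * S)) *
      ENNReal.ofReal (ε / (B * S * R ^ (d - 1)) * (M : ℝ) ^ (d - 1)) ≤
        ENNReal.ofReal (ℓ ^ d * (B * S)) * σ := by
    have e1 : ℓ ^ d * (B * S) * (ε / (B * S * R ^ (d - 1)) * (M : ℝ) ^ (d - 1)) = ε * ℓ := by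
      obtain ⟨n, rfl⟩ := Nat.exists_eq_succ_of_ne_zero (by omega : d ≠ 0)
      rw [hℓ, Nat.succ_eq_add_one, Nat.add_sub_cancel, div_pow, pow_succ, pow_succ]
      field_simp
    rw [← ENNReal.ofReal_mul hpos.le, e1]
    calc ENNReal.ofReal (ε * ℓ) ≤ ENNReal.ofReal ‖I‖ := ENNReal.ofReal_le_ofReal hlow
      _ = ‖I‖ₑ := ofReal_norm I
      _ ≤ _ := hup
      _ = _ := by rw [ENNReal.ofReal_mul (p := ℓ ^ d) (by positivity)]; ring
  exact (ENNReal.mul_le_mul_iff_right (ENNReal.ofReal_pos.2 hpos).ne' ENNReal.ofReal_ne_top).1 hfin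

/-- The bound is known only along N = (2M+1)^d. Monotonicity extends it to every large N, using the
largest M with (2M+1)^d ≤ N at the cost of a constant factor. -/
theorem liminf_rpow_mul_ne_zero {d : ℕ} (hd : 1 ≤ d) {σ : ℕ → ℝ≥0∞} (hσ : Monotone σ) {c : ℝ}
    (hc : 0 < c)
    (h : ∀ᶠ M : ℕ in atTop, ENNReal.ofReal (c * (M : ℝ) ^ (d - 1)) ≤ σ ((2 * M + 1) ^ d)) :
    liminf (fun N : ℕ => (N : ℝ≥0∞) ^ (-1 + 1 / (d : ℝ)) * σ N) atTop ≠ 0 := by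
  have hdr : (0 : ℝ) < d := by exact_mod_cast hd
  set t : ℕ → ℝ := fun N => (N : ℝ) ^ (1 / (d : ℝ)) with ht
  have htt : Tendsto t atTop atTop :=
    (tendsto_rpow_atTop (by positivity)).comp tendsto_natCast_atTop_atTop
  set m : ℕ → ℕ := fun N => ⌊(t N - 1) / 2⌋₊ with hm
  have hmt : Tendsto m atTop atTop := by
    refine tendsto_nat_floor_atTop.comp ?_
    exact (tendsto_atTop_add_const_right _ (-1) htt).atTop_div_const two_pos
  have hev : ∀ᶠ N : ℕ in atTop, ENNReal.ofReal (c * (1 / 5) ^ (d - 1)) ≤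
      (N : ℝ≥0∞) ^ (-1 + 1 / (d : ℝ)) * σ N := by
    filter_upwards [hmt.eventually h, hmt.eventually (eventually_ge_atTop 1),
      htt.eventually (eventually_ge_atTop 1), eventually_gt_atTop 0] with N h1 h2 h3 h4
    have hNr : (0 : ℝ) < N := by exact_mod_cast h4
    have htd : t N ^ d = N := by
      rw [ht, ← Real.rpow_natCast, ← Real.rpow_mul hNr.le, one_div_mul_cancel hdr.ne', Real.rpow_one]
    have hM1 : (m N : ℝ) ≤ (t N - 1) / 2 := Nat.floor_le (by linarith)
    have hM2 : (t N - 1) / 2 < m N + 1 := Nat.lt_floor_add_one _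
    have hM3 : (1 : ℝ) ≤ m N := by exact_mod_cast h2
    have hle : (2 * m N + 1) ^ d ≤ N := by
      have : ((2 * m N + 1 : ℝ)) ^ d ≤ t N ^ d := by
        gcongr
        linarith
      rw [htd] at this
      exact_mod_cast this
    have hN : (N : ℝ≥0∞) ^ (-1 + 1 / (d : ℝ)) = ENNReal.ofReal ((t N ^ (d - 1))⁻¹) := by
      rw [← ENNReal.ofReal_natCast, ENNReal.ofReal_rpow_of_pos hNr]
      congr 1
      rw [ht, ← Real.rpow_natCast, ← Real.rpow_mul hNr.le, ← Real.rpow_neg hNr.le]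
      congr 1
      rw [Nat.cast_sub hd]
      field_simp
      push_cast
      ring
    calc ENNReal.ofReal (c * (1 / 5) ^ (d - 1))
        ≤ ENNReal.ofReal ((t N ^ (d - 1))⁻¹ * (c * (m N : ℝ) ^ (d - 1))) := by
          refine ENNReal.ofReal_le_ofReal ?_
          -- By the choice of the integer part t < 2m + 3, which is at most 5m since m ≥ 1.
          have h5 : (1 / 5 : ℝ) ≤ (t N)⁻¹ * m N := by
            rw [inv_mul_eq_div, div_le_div_iff₀ (by norm_num) (by linarith)]
            linarith
          calc c * (1 / 5) ^ (d - 1) ≤ c * ((t N)⁻¹ * m N) ^ (d - 1) := by gcongr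
            _ = _ := by rw [mul_pow, inv_pow]; ring
      _ = ENNReal.ofReal ((t N ^ (d - 1))⁻¹) * ENNReal.ofReal (c * (m N : ℝ) ^ (d - 1)) :=
          ENNReal.ofReal_mul (by positivity)
      _ ≤ _ := by
          rw [hN]
          gcongr
          exact h1.trans (hσ hle)
  have hpos : 0 < ENNReal.ofReal (c * (1 / 5) ^ (d - 1)) := ENNReal.ofReal_pos.2 (by positivity)
  exact (hpos.trans_le (le_liminf_of_le (by isBoundedDefault) hev)).ne'

/-! ### Conclusion -/

/-- A nonzero singular integral operator has a nonzero kernel. -/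
theorem exists_kernel_ne_zero {d : ℕ} {k : E d → ℂ} {K : L2 d →L[ℂ] L2 d}
    (hK : IsSingularIntegral k K) (hK0 : K ≠ 0) : ∃ x, x ≠ 0 ∧ k x ≠ 0 := by
  by_contra hcon
  push Not at hcon
  refine hK0 ?_
  -- A vanishing kernel makes K vanish on test functions; hence every function in the range of the
  -- adjoint is orthogonal to all of them and is zero.
  have hadj : ContinuousLinearMap.adjoint K = 0 := by
    ext1 g
    set G := ContinuousLinearMap.adjoint K g with hG
    have hGl : LocallyIntegrable (fun y => conj (G y)) := by
      have h1 : MemLp (fun y => conj (G y)) 2 (volume : Measure (E d)) := (Lp.memLp G).star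
      exact h1.locallyIntegrable (by norm_num)
    have hz := ae_eq_zero_of_integral_contDiff_smul_eq_zero (μ := (volume : Measure (E d))) hGl ?_
    · refine (Lp.eq_zero_iff_ae_eq_zero).2 ?_
      filter_upwards [hz] with y hy
      simpa using hy
    intro ψ hψ hψc
    set ψc : E d → ℂ := fun y => (ψ y : ℂ) with hψcdef
    have hψs : ContDiff ℝ ∞ ψc := Complex.ofRealCLM.contDiff.comp hψ
    have hψcs : HasCompactSupport ψc := hψc.comp_left (g := Complex.ofReal) Complex.ofReal_zero
    have hψ2 : MemLp ψc 2 (volume : Measure (E d)) :=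
      hψs.continuous.memLp_of_hasCompactSupport hψcs
    have e1 : ∫ y, ψ y • conj (G y) = ⟪G, hψ2.toLp ψc⟫_ℂ := by
      rw [L2.inner_def]
      refine integral_congr_ae ?_
      filter_upwards [hψ2.coeFn_toLp] with y hy
      rw [hy, RCLike.inner_apply, Complex.real_smul]
    have e2 : K (hψ2.toLp ψc) = 0 := by
      refine (Lp.eq_zero_iff_ae_eq_zero).2 ?_
      filter_upwards [hK ψc hψs hψcs hψ2] with x hx
      refine tendsto_nhds_unique hx (tendsto_const_nhds.congr' ?_)
      filter_upwards [self_mem_nhdsWithin] with ε hε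
      have hm : MeasurableSet {y : E d | ε < ‖x - y‖} :=
        measurableSet_lt measurable_const (measurable_const.sub measurable_id).norm
      refine (setIntegral_eq_zero_of_forall_eq_zero fun y hy => ?_).symm
      have hy' : ε < ‖x - y‖ := hy
      rw [hcon (x - y) (norm_pos_iff.1 (lt_trans hε hy')), zero_mul]
    rw [e1, hG, ContinuousLinearMap.adjoint_inner_left, e2, inner_zero_right]
  rw [← ContinuousLinearMap.adjoint_adjoint K, hadj, map_zero]

/-- A locally integrable function all of whose regularizations have vanishing derivative at the
origin is constant. -/
theorem exists_ae_eq_const_of_fderiv_pairing_eq_zero {d : ℕ} {f : E d → ℂ}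
    (hf : LocallyIntegrable f)
    (h : ∀ η : E d → ℝ, ContDiff ℝ ∞ η → HasCompactSupport η → fderiv ℝ (pairing f η) 0 = 0) :
    ∃ c : ℂ, f =ᵐ[volume] fun _ => c := by
  have hconst : ∀ η : E d → ℝ, ContDiff ℝ ∞ η → HasCompactSupport η → ∀ x y,
      pairing f η x = pairing f η y := by
    intro η hη hηc
    refine is_const_of_fderiv_eq_zero (𝕜 := ℝ)
      ((contDiff_pairing hf hη hηc).differentiable (by simp)) fun z => ?_
    -- Moving the base point to z amounts to translating η, so the hypothesis at the origin controls
    -- the derivative everywhere.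
    have h1 : ∀ x, pairing f η (z + x) = pairing f (fun a => η (a - z)) x := by
      intro x
      simp only [pairing]
      rw [← integral_add_right_eq_self (fun a => ((η (a - z) : ℝ) : ℂ) * f (a + x)) z]
      refine integral_congr_ae (ae_of_all _ fun a => ?_)
      simp [add_assoc]
    have h2 := h (fun a => η (a - z)) (hη.comp (contDiff_id.sub contDiff_const))
      (hηc.comp_homeomorph (Homeomorph.subRight z))
    have h3 : (fun x => pairing f η (z + x)) = pairing f (fun a => η (a - z)) := funext h1
    rw [← h3, fderiv_comp_add_left, add_zero] at h2
    exact h2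
  -- An approximate identity with outer and inner radii in the fixed ratio 2, as the almost
  -- everywhere convergence theorem requires. The bumps are even, so convolution with them is a
  -- pairing.
  let b : ℕ → ContDiffBump (0 : E d) := fun n =>
    ⟨1 / (n + 1), 2 * (1 / (n + 1)), by positivity, by
      have : (0 : ℝ) < 1 / (n + 1) := by positivity
      linarith⟩
  have hb : Tendsto (fun n => (b n).rOut) atTop (𝓝 0) := by
    have := (tendsto_one_div_add_atTop_nhds_zero_nat (𝕜 := ℝ)).const_mul 2
    simpa [b] using this
  have hconv := ContDiffBump.ae_convolution_tendsto_right_of_locallyIntegrable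
    (μ := (volume : Measure (E d))) (K := 2) hb (Eventually.of_forall fun n => le_rfl) hf
  have heq : ∀ n, convolution ((b n).normed volume) f (ContinuousLinearMap.lsmul ℝ ℝ) volume =
      pairing f ((b n).normed volume) := by
    intro n
    rw [pairing_eq_convolution]
    congr 1
    funext x
    rw [(b n).normed_neg]
  simp only [heq] at hconv
  obtain ⟨x₀, hx₀⟩ := hconv.exists
  refine ⟨f x₀, ?_⟩
  filter_upwards [hconv] with x hx
  refine tendsto_nhds_unique hx (hx₀.congr fun n => ?_)
  exact hconst _ (b n).contDiff_normed (b n).hasCompactSupport_normed _ _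

end CZCommutator

theorem corollary1p2 {d : ℕ} (hd : 2 ≤ d)
    (K : CZCommutator.L2 d →L[ℂ] CZCommutator.L2 d)
    (hK : CZCommutator.IsCZOperator K) (hK0 : K ≠ 0)
    (f : CZCommutator.E d → ℂ) (hf : CZCommutator.MemCMO f)
    (hlim : liminf (fun N : ℕ => (N : ℝ≥0∞) ^ (-1 + 1 / (d : ℝ)) *
      ∑ n ∈ Finset.range N, CZCommutator.singularValue (CZCommutator.commutator K f) n) atTop = 0) :
    ∃ c : ℂ, f =ᵐ[volume] fun _ => c := by
  have hd1 : 1 ≤ d := by omega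
  obtain ⟨k, hk, hkK⟩ := hK
  obtain ⟨f', hf'm, hff'⟩ := hf.1.1.aestronglyMeasurable
  have hf' : LocallyIntegrable f' := hf.1.1.congr hff'
  obtain ⟨x₀, hx₀, hkx₀⟩ := CZCommutator.exists_kernel_ne_zero hkK hK0
  -- A nonzero directional derivative would give the lower bound N^(1-1/d) for the partial sums and
  -- contradict `hlim`.
  have hzero : ∀ η : CZCommutator.E d → ℝ, ContDiff ℝ ∞ η → HasCompactSupport η →
      ∀ w, w ≠ 0 → k (-w) ≠ 0 → fderiv ℝ (CZCommutator.pairing f' η) 0 w = 0 := by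
    intro η hη hηc w hw hkw
    by_contra hne
    obtain ⟨c, hc, hev⟩ := CZCommutator.exists_ofReal_le_sum_singularValue hd1 hk hkK hf.1 hff'
      hf'm.measurable hη hηc hw (mul_ne_zero hkw hne)
    exact CZCommutator.liminf_rpow_mul_ne_zero hd1
      (σ := fun N => ∑ n ∈ Finset.range N,
        CZCommutator.singularValue (CZCommutator.commutator K f) n)
      (fun a b hab => Finset.sum_le_sum_of_subset (Finset.range_mono hab)) hc hev hlim
  obtain ⟨c, hc⟩ := CZCommutator.exists_ae_eq_const_of_fderiv_pairing_eq_zero hf' fun η hη hηc => by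
    set A := fderiv ℝ (CZCommutator.pairing f' η) 0
    have hcont : ContinuousAt k x₀ :=
      hk.smooth.continuousOn.continuousAt (isOpen_compl_singleton.mem_nhds hx₀)
    have hev : ∀ᶠ x in 𝓝 x₀, x ≠ 0 ∧ k x ≠ 0 :=
      (eventually_ne_nhds hx₀).and (hcont.eventually_ne hkx₀)
    have hA : ∀ᶠ x in 𝓝 x₀, A x = 0 := by
      filter_upwards [hev] with x hx
      have := hzero η hη hηc (-x) (neg_ne_zero.2 hx.1) (by rw [neg_neg]; exact hx.2)
      rw [map_neg, neg_eq_zero] at this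
      exact this
    -- The linear map A vanishes near x₀, in particular at x₀ + tv for some t ≠ 0; as it also
    -- vanishes at x₀, it vanishes at v.
    ext v
    have hpath : Tendsto (fun t : ℝ => x₀ + t • v) (𝓝[≠] 0) (𝓝 x₀) := by
      have : Tendsto (fun t : ℝ => x₀ + t • v) (𝓝 0) (𝓝 (x₀ + (0 : ℝ) • v)) :=
        Continuous.tendsto (by fun_prop) 0
      rw [zero_smul, add_zero] at this
      exact this.mono_left nhdsWithin_le_nhds
    obtain ⟨t, ht, ht0⟩ := ((hpath.eventually hA).and self_mem_nhdsWithin).exists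
    rw [map_add, hA.self_of_nhds, zero_add, map_smul] at ht
    exact (smul_eq_zero.1 ht).resolve_left ht0
  exact ⟨c, hff'.trans hc⟩
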